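/- Let $m$ be the finite measure $dm(t)=\frac{t}{e^t-1}\,dt$ on $(0,\infty)$, and let $\mathcal H_1$ be the Hilbert space of all functions $f=\mathcal L[\varphi]$, $f(w)=\int_0^\infty e^{-tw}\varphi(t)\,dm(t)$ $(\mathrm{Re}\,w>-\tfrac12)$, with $\varphi\in L_2(m)$, endowed with the inner product $(f_1,f_2)=\int_0^\infty\overline{\varphi_1}\,\varphi_2\,dm$ if $f_i=\mathcal L[\varphi_i]$. For $|z|<1$ let $$(\mathcal Q_zf)(w)=\sum_{n=1}^\infty \frac{z^n}{(w+n)^2}\,f\!\left(\frac1{w+n}\right).$$ On $L_2(m)$ let $(M\varphi)(t)=e^{-t}\varphi(t)$ and $(\mathcal K\varphi)(t)=\int_0^\infty \frac{J_1(2\sqrt{st})}{\sqrt{st}}\,\varphi(s)\,dm(s)$, where $J_1$ is the Bessel function of the first kind of order $1$, and for $z\in\mathbb C\setminus[1,\infty)$ let $\mathcal K_z=z\,(1-M)(1-zM)^{-1}\mathcal K$. Then, for $|z|<1$, $\mathcal Q_z$ is a bounded operator on $\mathcal H_1$, $1-\mathcal Q_z$ has a bounded inverse on $\mathcal H_1$,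 and the operator-valued function $z\mapsto(1-\mathcal Q_z)^{-1}$ is analytic in the open unit disk $\{|z|<1\}$. The function $z\mapsto\mathcal Q_z$ continues analytically to $\mathbb C\setminus[1,\infty)$ as a function with values in the bounded operators on $\mathcal H_1$, and, with $\mathcal Q_z$ denoting this continuation, $z\mapsto(1-\mathcal Q_z)^{-1}$ is a meromorphic continuation of the above function to $\mathbb C\setminus[1,\infty)$. Its poles are exactly the points $z\in\mathbb C\setminus[1,\infty)$ for which $1$ is an eigenvalue of $\mathcal K_z$ on $L_2(m)$; at every other point $z\in\mathbb C\setminus[1,\infty)$ the operator $1-\mathcal Q_z$ has a bounded inverse and the function is analytic. -/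

import Mathlib

open MeasureTheory Set Filter Topology
open scoped ENNReal
noncomputable section
namespace FareyGauss

/-- The density `t / (e^t - 1)` of the measure `m` on the positive half-line. -/
def mDensity (t : ℝ) : ℝ := t / (Real.exp t - 1)

/-- The measure `dm(t) = t / (e^t - 1) dt` on `(0, ∞)`. -/
def m : Measure ℝ :=
  (volume.restrict (Ioi 0)).withDensity fun t => ENNReal.ofReal (mDensity t)

theorem measurable_mDensity : Measurable mDensity := by
  unfold mDensity; fun_prop

theorem mDensity_nonneg {t : ℝ} (ht : 0 < t) : 0 ≤ mDensity t := by
  have : 1 ≤ Real.exp t := Real.one_le_exp ht.le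
  exact div_nonneg ht.le (by linarith)

theorem mDensity_le {t : ℝ} (ht : 0 < t) : mDensity t ≤ (1 + t) * Real.exp (-t) := by
  have h1 : 0 < Real.exp t - 1 := by linarith [Real.add_one_lt_exp ht.ne']
  unfold mDensity
  rw [div_le_iff₀ h1, Real.exp_neg]
  have h2 : t + 1 ≤ Real.exp t := Real.add_one_le_exp t
  have h3 : 0 < Real.exp t := Real.exp_pos t
  field_simp
  nlinarith

/-- `e^{-ct}` is integrable with respect to `m` as soon as `-1 < c`. -/
theorem integrable_exp_m {c : ℝ} (hc : -1 < c) : Integrable (fun t => Real.exp (-c * t)) m := by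
  unfold m
  rw [integrable_withDensity_iff_integrable_smul₀' (by
    exact measurable_mDensity.ennreal_ofReal.aemeasurable) (by simp)]
  set ε : ℝ := min 1 ((1 + c) / 2) with hε
  have he0 : 0 < ε := lt_min one_pos (by linarith)
  have he1 : ε ≤ 1 := min_le_left _ _
  have he2 : ε ≤ (1 + c) / 2 := min_le_right _ _
  have hint : Integrable (fun t => ε⁻¹ * Real.exp (-(1 + c - ε) * t))
      (volume.restrict (Ioi 0)) :=
    (exp_neg_integrableOn_Ioi 0 (by linarith : 0 < 1 + c - ε)).const_mul _
  refine hint.mono' ?_ ?_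
  · have := measurable_mDensity
    exact (by fun_prop : Measurable _).aestronglyMeasurable
  · refine (ae_restrict_iff' measurableSet_Ioi).2 (.of_forall fun t ht => ?_)
    have ht : 0 < t := ht
    rw [ENNReal.toReal_ofReal (mDensity_nonneg ht), norm_smul, Real.norm_eq_abs,
      Real.norm_eq_abs, abs_of_nonneg (mDensity_nonneg ht), abs_of_pos (Real.exp_pos _)]
    have h1 : 1 + t ≤ ε⁻¹ * Real.exp (ε * t) := by
      rw [inv_mul_eq_div, le_div_iff₀ he0]
      nlinarith [Real.add_one_le_exp (ε * t)]
    calc mDensity t * Real.exp (-c * t)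
        ≤ (ε⁻¹ * Real.exp (ε * t) * Real.exp (-t)) * Real.exp (-c * t) := by
          gcongr
          exact (mDensity_le ht).trans (by gcongr)
      _ = ε⁻¹ * Real.exp (-(1 + c - ε) * t) := by
          rw [mul_assoc, mul_assoc, ← Real.exp_add, ← Real.exp_add]
          ring_nf

instance : IsFiniteMeasure m := by
  have h := integrable_exp_m (c := 0) (by norm_num)
  simp only [neg_zero, zero_mul, Real.exp_zero] at h
  simpa using (integrable_const_iff.1 h)

/-- The Hilbert space `L₂(m)`. -/
abbrev L2m : Type := Lp ℂ 2 m

/-- The half-plane `Re w > -1/2`, on which the integrals below converge absolutely. -/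
def HalfPlane : Type := {w : ℂ // -(1 / 2) < w.re}

theorem memLp_cexp (w : HalfPlane) :
    MemLp (fun t : ℝ => Complex.exp (-(t : ℂ) * w.1)) 2 m := by
  rw [memLp_two_iff_integrable_sq_norm (by fun_prop)]
  have h := integrable_exp_m (c := 2 * w.1.re) (by linarith [w.2])
  refine h.congr (.of_forall fun t => ?_)
  simp only [Complex.norm_exp]
  rw [← Real.exp_nat_mul]
  congr 1
  simp
  ring

theorem integrable_laplace (w : HalfPlane) (φ : L2m) :
    Integrable (fun t : ℝ => Complex.exp (-(t : ℂ) * w.1) * φ t) m :=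
  (memLp_cexp w).integrable_mul (Lp.memLp φ)

/-- The generalized Laplace transform `(𝓛[φ])(w) = ∫ e^{-tw} φ(t) dm(t)`. -/
def laplace : L2m →ₗ[ℂ] (HalfPlane → ℂ) where
  toFun φ w := ∫ t : ℝ, Complex.exp (-(t : ℂ) * w.1) * φ t ∂m
  map_add' φ ψ := by
    funext w
    rw [Pi.add_apply, ← integral_add (integrable_laplace w φ) (integrable_laplace w ψ)]
    refine integral_congr_ae ?_
    filter_upwards [Lp.coeFn_add φ ψ] with t ht
    rw [ht, Pi.add_apply, mul_add]
  map_smul' c φ := by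
    funext w
    rw [Pi.smul_apply, RingHom.id_apply, smul_eq_mul, ← integral_const_mul]
    refine integral_congr_ae ?_
    filter_upwards [Lp.coeFn_smul c φ] with t ht
    rw [ht, Pi.smul_apply, smul_eq_mul]
    ring

theorem ae_eq_zero_of_fourier {u : ℝ → ℝ} (hu : Integrable u m)
    (h : ∀ ξ : ℝ, ∫ t : ℝ, Complex.exp (ξ * t * Complex.I) * (u t : ℂ) ∂m = 0) :
    u =ᵐ[m] 0 := by
  have key : ∀ v : ℝ → ℝ, Integrable v m → ∀ ξ : ℝ,
      charFun (m.withDensity fun t => ENNReal.ofReal (v t)) ξ =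
        ∫ t : ℝ, Complex.exp (ξ * t * Complex.I) * ((max (v t) 0 : ℝ) : ℂ) ∂m := by
    intro v hv ξ
    rw [charFun_apply_real, integral_withDensity_eq_integral_toReal_smul₀
      hv.aemeasurable.ennreal_ofReal (by simp)]
    refine integral_congr_ae (.of_forall fun t => ?_)
    simp only [ENNReal.toReal_ofReal', Complex.real_smul]
    ring
  have fin : ∀ v : ℝ → ℝ, Integrable v m →
      IsFiniteMeasure (m.withDensity fun t => ENNReal.ofReal (v t)) := fun v hv =>
    isFiniteMeasure_withDensity_ofReal hv.2
  have i1 := fin u hu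
  have i2 := fin (-u) hu.neg
  have ibd : ∀ v : ℝ → ℝ, Integrable v m → ∀ ξ : ℝ,
      Integrable (fun t : ℝ => Complex.exp (ξ * t * Complex.I) * ((max (v t) 0 : ℝ) : ℂ)) m := by
    intro v hv ξ
    refine Integrable.bdd_mul (c := 1) (hv.pos_part.ofReal) (by fun_prop) (.of_forall fun t => ?_)
    rw [← Complex.ofReal_mul, Complex.norm_exp_ofReal_mul_I]
  have heq : (m.withDensity fun t => ENNReal.ofReal (u t)) =
      m.withDensity fun t => ENNReal.ofReal ((-u) t) := by
    refine Measure.ext_of_charFun (funext fun ξ => ?_)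
    rw [key u hu, key (-u) hu.neg, ← sub_eq_zero, ← integral_sub (ibd u hu ξ) (ibd _ hu.neg ξ),
      ← h ξ]
    refine integral_congr_ae (.of_forall fun t => ?_)
    simp only [Pi.neg_apply]
    rw [← mul_sub, ← Complex.ofReal_sub]
    congr 2
    rcases le_total (u t) 0 with hh | hh
    · rw [max_eq_right hh, max_eq_left (by linarith)]; ring
    · rw [max_eq_left hh, max_eq_right (by linarith)]; ring
  have := (withDensity_eq_iff hu.aemeasurable.ennreal_ofReal
    hu.neg.aemeasurable.ennreal_ofReal (by
      have := hu.lintegral_lt_top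
      exact this.ne)).1 heq
  filter_upwards [this] with t ht
  simp only [Pi.neg_apply] at ht
  have ht' := congrArg ENNReal.toReal ht
  simp only [ENNReal.toReal_ofReal'] at ht'
  simp only [Pi.zero_apply]
  rcases le_total (u t) 0 with hh | hh
  · rw [max_eq_right hh, max_eq_left (by linarith)] at ht'; linarith
  · rw [max_eq_left hh, max_eq_right (by linarith)] at ht'; linarith

theorem laplace_injective : Function.Injective laplace := by
  refine (injective_iff_map_eq_zero laplace).2 fun φ hφ => ?_
  have hint : Integrable φ m := (Lp.memLp φ).integrable (by norm_num)
  have hF : ∀ ξ : ℝ, ∫ t : ℝ, Complex.exp (ξ * t * Complex.I) * φ t ∂m = 0 := by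
    intro ξ
    have := congrFun hφ ⟨-(ξ * Complex.I), by simp⟩
    refine Eq.trans ?_ this
    refine integral_congr_ae (.of_forall fun t => ?_)
    simp only
    congr 2
    ring
  have hG : ∀ ξ : ℝ, ∫ t : ℝ, Complex.exp (ξ * t * Complex.I) *
      (starRingEnd ℂ) (φ t) ∂m = 0 := by
    intro ξ
    have := congrArg (starRingEnd ℂ) (hF (-ξ))
    rw [← integral_conj, map_zero] at this
    refine Eq.trans ?_ this
    refine integral_congr_ae (.of_forall fun t => ?_)
    simp [← Complex.exp_conj]
  have hconj : Integrable (fun t => (starRingEnd ℂ) (φ t)) m :=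
    (LinearIsometryEquiv.integrable_comp_iff (φ := φ) Complex.conjLIE).2 hint
  have ib : ∀ (ξ : ℝ) {v : ℝ → ℂ}, Integrable v m →
      Integrable (fun t : ℝ => Complex.exp (ξ * t * Complex.I) * v t) m := by
    intro ξ v hv
    refine Integrable.bdd_mul (c := 1) hv (by fun_prop) (.of_forall fun t => ?_)
    rw [← Complex.ofReal_mul, Complex.norm_exp_ofReal_mul_I]
  have hre := ae_eq_zero_of_fourier (u := fun t => (φ t).re) hint.re fun ξ => by
    have : ∀ t : ℝ, Complex.exp (ξ * t * Complex.I) * ((φ t).re : ℂ) =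
        (1 / 2) * (Complex.exp (ξ * t * Complex.I) * φ t +
          Complex.exp (ξ * t * Complex.I) * (starRingEnd ℂ) (φ t)) := by
      intro t
      rw [← mul_add, Complex.add_conj]; push_cast; ring
    simp_rw [this]
    rw [integral_const_mul, integral_add (ib ξ hint) (ib ξ hconj), hF, hG]
    simp
  have him := ae_eq_zero_of_fourier (u := fun t => (φ t).im) hint.im fun ξ => by
    have : ∀ t : ℝ, Complex.exp (ξ * t * Complex.I) * ((φ t).im : ℂ) =
        (-Complex.I / 2) * (Complex.exp (ξ * t * Complex.I) * φ t -
          Complex.exp (ξ * t * Complex.I) * (starRingEnd ℂ) (φ t)) := by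
      intro t
      rw [← mul_sub, Complex.sub_conj]; push_cast; ring_nf; simp
    simp_rw [this]
    rw [integral_const_mul, integral_sub (ib ξ hint) (ib ξ hconj), hF, hG]
    simp
  refine (Lp.eq_zero_iff_ae_eq_zero).2 ?_
  filter_upwards [hre, him] with t h1 h2
  exact Complex.ext h1 h2

/-- The space `H₁` of all generalized Laplace transforms `𝓛[φ]`, `φ ∈ L₂(m)`, as functions on the
half-plane `Re w > -1/2`.  (A type of its own, so that it carries only the Hilbert space structure
defined below and not the topology of pointwise convergence.) -/
def H1 : Type := LinearMap.range laplace

instance : AddCommGroup H1 := inferInstanceAs (AddCommGroup (LinearMap.range laplace))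

instance : Module ℂ H1 := inferInstanceAs (Module ℂ (LinearMap.range laplace))

instance : CoeFun H1 fun _ => HalfPlane → ℂ := ⟨fun f => f.1⟩

/-- The linear bijection `φ ↦ 𝓛[φ]` of `L₂(m)` onto `H₁`. -/
def laplaceEquiv : L2m ≃ₗ[ℂ] H1 := LinearEquiv.ofInjective laplace laplace_injective

/-- The inner product of `H₁`: `(f₁, f₂) = ∫ conj (φ₁) φ₂ dm` if `fᵢ = 𝓛[φᵢ]`. -/
abbrev h1Core : InnerProductSpace.Core ℂ H1 where
  inner f g := inner ℂ (laplaceEquiv.symm f) (laplaceEquiv.symm g)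
  conj_inner_symm f g := inner_conj_symm _ _
  re_inner_nonneg f := inner_self_nonneg
  add_left f g h := by simp only [map_add, inner_add_left]
  smul_left f g c := by simp only [map_smul, inner_smul_left]
  definite f h := by
    have := inner_self_eq_zero.1 h
    simpa using this

instance : NormedAddCommGroup H1 := h1Core.toNormedAddCommGroup

instance : InnerProductSpace ℂ H1 := InnerProductSpace.ofCore h1Core.toCore

theorem h1_inner_laplace (φ ψ : L2m) :
    inner ℂ (laplaceEquiv φ) (laplaceEquiv ψ) =
      ∫ t : ℝ, (starRingEnd ℂ) (φ t) * ψ t ∂m := by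
  change inner ℂ (laplaceEquiv.symm (laplaceEquiv φ)) (laplaceEquiv.symm (laplaceEquiv ψ)) = _
  rw [LinearEquiv.symm_apply_apply, LinearEquiv.symm_apply_apply, L2.inner_def]
  refine integral_congr_ae (.of_forall fun t => ?_)
  simp [mul_comm]

/-- The Laplace transform as an isometry of `L₂(m)` onto `H₁`. -/
def laplaceIsometry : L2m ≃ₗᵢ[ℂ] H1 :=
  laplaceEquiv.isometryOfInner fun φ ψ => by
    change inner ℂ (laplaceEquiv.symm (laplaceEquiv φ)) (laplaceEquiv.symm (laplaceEquiv ψ)) = _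
    rw [LinearEquiv.symm_apply_apply, LinearEquiv.symm_apply_apply]

instance : CompleteSpace H1 :=
  (completeSpace_congr (e := laplaceIsometry.toEquiv)
    laplaceIsometry.isometry.isUniformEmbedding).1 inferInstance

/-- The Bessel function `J_p` of the first kind, of integer order `p`. -/
def besselJ (p : ℕ) (x : ℝ) : ℝ :=
  ∑' k : ℕ, (-1) ^ k / ((k.factorial : ℝ) * ((k + p).factorial : ℝ)) * (x / 2) ^ (2 * k + p)

/-- The series `∑ (-x)^k / (k! (k+p)!)`, so that `J_p(x) = (x/2)^p c_p(x²/4)`. -/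
def besselC (p : ℕ) (x : ℝ) : ℝ :=
  ∑' k : ℕ, (-x) ^ k / ((k.factorial : ℝ) * ((k + p).factorial : ℝ))

theorem besselC_term_le (p k : ℕ) {x R : ℝ} (hx : |x| ≤ R) :
    ‖(-x) ^ k / ((k.factorial : ℝ) * ((k + p).factorial : ℝ))‖ ≤ R ^ k / (k.factorial : ℝ) := by
  have h1 : (1 : ℝ) ≤ ((k + p).factorial : ℝ) := by exact_mod_cast (k + p).factorial_pos
  have h2 : (0 : ℝ) < (k.factorial : ℝ) := by exact_mod_cast k.factorial_pos
  have hR : 0 ≤ R := (abs_nonneg x).trans hx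
  rw [norm_div, norm_pow, norm_neg, Real.norm_eq_abs, Real.norm_of_nonneg (by positivity)]
  gcongr
  nlinarith

theorem summable_besselC (p : ℕ) (x : ℝ) :
    Summable fun k : ℕ => (-x) ^ k / ((k.factorial : ℝ) * ((k + p).factorial : ℝ)) :=
  .of_norm_bounded (Real.summable_pow_div_factorial |x|) fun k => besselC_term_le p k le_rfl

theorem besselJ_eq (p : ℕ) (x : ℝ) : besselJ p x = (x / 2) ^ p * besselC p (x ^ 2 / 4) := by
  unfold besselJ besselC
  rw [← tsum_mul_left]
  refine tsum_congr fun k => ?_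
  rw [pow_add, pow_mul, neg_pow (x ^ 2 / 4)]
  have : (x / 2) ^ 2 = x ^ 2 / 4 := by ring
  rw [this]
  ring

theorem hasDerivAt_besselC (p : ℕ) (x : ℝ) :
    HasDerivAt (besselC p) (-besselC (p + 1) x) x := by
  set R : ℝ := |x| + 1
  have hu : Summable fun k : ℕ => ((k : ℝ) * R ^ (k - 1)) / (k.factorial : ℝ) := by
    rw [← summable_nat_add_iff 1]
    refine (Real.summable_pow_div_factorial R).congr fun k => ?_
    rw [Nat.factorial_succ, Nat.add_sub_cancel]
    push_cast
    have : (k.factorial : ℝ) ≠ 0 := by exact_mod_cast k.factorial_ne_zero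
    field_simp
  have hg : ∀ (k : ℕ) (y : ℝ), y ∈ Metric.ball (0 : ℝ) R →
      HasDerivAt (fun y : ℝ => (-y) ^ k / ((k.factorial : ℝ) * ((k + p).factorial : ℝ)))
        ((k * (-y) ^ (k - 1) * (-1)) / ((k.factorial : ℝ) * ((k + p).factorial : ℝ))) y := by
    intro k y _
    exact ((hasDerivAt_neg y).pow k).div_const _
  have hb : ∀ (k : ℕ) (y : ℝ), y ∈ Metric.ball (0 : ℝ) R →
      ‖(k * (-y) ^ (k - 1) * (-1)) / ((k.factorial : ℝ) * ((k + p).factorial : ℝ))‖ ≤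
        ((k : ℝ) * R ^ (k - 1)) / (k.factorial : ℝ) := by
    intro k y hy
    have hy' : |y| ≤ R := by simpa using (Metric.mem_ball.1 hy).le
    have h1 : (1 : ℝ) ≤ ((k + p).factorial : ℝ) := by exact_mod_cast (k + p).factorial_pos
    have h2 : (0 : ℝ) < (k.factorial : ℝ) := by exact_mod_cast k.factorial_pos
    rw [norm_div, norm_mul, norm_mul, norm_pow, norm_neg, norm_neg, Real.norm_eq_abs y,
      Real.norm_of_nonneg (by positivity : (0 : ℝ) ≤ k.factorial * ((k + p).factorial : ℝ)),
      norm_one, mul_one, Real.norm_of_nonneg (Nat.cast_nonneg k)]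
    gcongr
    nlinarith
  have hx : x ∈ Metric.ball (0 : ℝ) R := by simp [R]
  have h := hasDerivAt_tsum_of_isPreconnected hu Metric.isOpen_ball
    (convex_ball (0 : ℝ) R).isPreconnected hg hb hx (summable_besselC p x) hx
  refine h.congr_deriv ?_
  have hs : Summable fun k : ℕ =>
      (k * (-x) ^ (k - 1) * (-1)) / ((k.factorial : ℝ) * ((k + p).factorial : ℝ)) :=
    .of_norm_bounded hu fun k => hb k x hx
  rw [hs.tsum_eq_zero_add]
  unfold besselC
  rw [← tsum_neg]
  simp only [CharP.cast_eq_zero, zero_mul, zero_div, zero_add]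
  refine tsum_congr fun k => ?_
  rw [Nat.factorial_succ, Nat.add_sub_cancel, show k + 1 + p = k + (p + 1) by ring]
  push_cast
  have h1 : (k.factorial : ℝ) ≠ 0 := by exact_mod_cast k.factorial_ne_zero
  have h2 : ((k + (p + 1)).factorial : ℝ) ≠ 0 := by exact_mod_cast Nat.factorial_ne_zero _
  have h3 : (k : ℝ) + 1 ≠ 0 := by positivity
  field_simp

theorem besselC_rec (p : ℕ) (x : ℝ) :
    besselC p x = (p + 1) * besselC (p + 1) x - x * besselC (p + 2) x := by
  have hs := (summable_besselC p x).sub ((summable_besselC (p + 1) x).mul_left ((p : ℝ) + 1))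
  have key : besselC p x - (p + 1) * besselC (p + 1) x = -x * besselC (p + 2) x := by
    unfold besselC
    rw [← tsum_mul_left, ← (summable_besselC p x).tsum_sub
      ((summable_besselC (p + 1) x).mul_left ((p : ℝ) + 1)), hs.tsum_eq_zero_add, ← tsum_mul_left]
    have h0 : (p.factorial : ℝ) ≠ 0 := by exact_mod_cast p.factorial_ne_zero
    have h0' : (p : ℝ) + 1 ≠ 0 := by positivity
    have hz : (-x) ^ 0 / (((0 : ℕ).factorial : ℝ) * ((0 + p).factorial : ℝ)) -
        (p + 1) * ((-x) ^ 0 / (((0 : ℕ).factorial : ℝ) * ((0 + (p + 1)).factorial : ℝ))) = 0 := by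
      simp only [zero_add, Nat.factorial_succ, Nat.factorial_zero]
      push_cast
      field_simp
      ring
    rw [hz, zero_add]
    refine tsum_congr fun k => ?_
    have h1 : (k.factorial : ℝ) ≠ 0 := by exact_mod_cast k.factorial_ne_zero
    have h2 : ((k + 1 + p).factorial : ℝ) ≠ 0 := by exact_mod_cast Nat.factorial_ne_zero _
    have h3 : (k : ℝ) + 1 ≠ 0 := by positivity
    have h4 : (k : ℝ) + 1 + p + 1 ≠ 0 := by positivity
    rw [show k + 1 + (p + 1) = (k + 1 + p) + 1 by ring,
      show k + (p + 2) = (k + 1 + p) + 1 by ring, Nat.factorial_succ k,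
      Nat.factorial_succ (k + 1 + p)]
    push_cast
    field_simp
    ring
  linarith

/-- `|J₁(2√x) / √x| ≤ 1` in the form used below. -/
theorem abs_besselC_one_le {x : ℝ} (hx : 0 ≤ x) : |besselC 1 x| ≤ 1 := by
  set E : ℝ → ℝ := fun y => besselC 1 y ^ 2 + y * besselC 2 y ^ 2 with hE
  have hd : ∀ y, HasDerivAt E (-3 * besselC 2 y ^ 2) y := by
    intro y
    have h1 := hasDerivAt_besselC 1 y
    have h2 := hasDerivAt_besselC 2 y
    refine ((h1.pow 2).add ((hasDerivAt_id y).mul (h2.pow 2))).congr_deriv ?_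
    have h3 := besselC_rec 1 y
    norm_num at h3 ⊢
    rw [h3]
    ring
  have hanti : AntitoneOn E (Ici 0) := by
    refine antitoneOn_of_deriv_nonpos (convex_Ici 0)
      (fun y _ => (hd y).continuousAt.continuousWithinAt)
      (fun y _ => (hd y).differentiableAt.differentiableWithinAt) fun y _ => ?_
    rw [(hd y).deriv]
    nlinarith [sq_nonneg (besselC 2 y)]
  have h0 : E 0 = 1 := by
    have : besselC 1 0 = 1 := by
      unfold besselC
      rw [tsum_eq_single 0 (by intro k hk; simp [hk])]
      simp
    simp [hE, this]
  have h1 := hanti (mem_Ici.2 le_rfl) (mem_Ici.2 hx) hx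
  rw [h0] at h1
  have h2 : 0 ≤ x * besselC 2 x ^ 2 := by positivity
  rw [← sq_le_one_iff_abs_le_one]
  simp only [hE] at h1
  linarith

/-- The kernel `J₁(2√(st)) / √(st)`. -/
def kernelK (s t : ℝ) : ℝ := besselJ 1 (2 * √(s * t)) / √(s * t)

theorem measurable_kernelK : Measurable fun q : ℝ × ℝ => kernelK q.1 q.2 := by
  have h : Continuous (besselC 1) :=
    continuous_iff_continuousAt.2 fun x => (hasDerivAt_besselC 1 x).continuousAt
  have hJ : Continuous (besselJ 1) := by
    have : besselJ 1 = fun x => (x / 2) ^ 1 * besselC 1 (x ^ 2 / 4) := funext (besselJ_eq 1)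
    rw [this]
    fun_prop
  unfold kernelK
  exact (hJ.measurable.comp (by fun_prop)).div (by fun_prop)

theorem abs_kernelK_le (s t : ℝ) : |kernelK s t| ≤ 1 := by
  unfold kernelK
  rw [besselJ_eq]
  set r := √(s * t)
  rcases eq_or_ne r 0 with h | h
  · simp [h]
  · have : (2 * r / 2) ^ 1 * besselC 1 ((2 * r) ^ 2 / 4) / r = besselC 1 (r ^ 2) := by
      have e : (2 * r) ^ 2 / 4 = r ^ 2 := by ring
      rw [e]; field_simp
    rw [this]
    exact abs_besselC_one_le (sq_nonneg r)

theorem integrable_kernelK_mul (φ : L2m) (t : ℝ) :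
    Integrable (fun s : ℝ => (kernelK s t : ℂ) * φ s) m := by
  have hφ : Integrable φ m := (Lp.memLp φ).integrable (by norm_num)
  refine Integrable.bdd_mul (c := 1) hφ ?_ (.of_forall fun s => ?_)
  · exact (Complex.measurable_ofReal.comp
      (measurable_kernelK.comp (measurable_id.prodMk measurable_const))).aestronglyMeasurable
  · rw [Complex.norm_real]; exact abs_kernelK_le s t

theorem norm_kernelK_integral_le (φ : L2m) (t : ℝ) :
    ‖∫ s : ℝ, (kernelK s t : ℂ) * φ s ∂m‖ ≤ ∫ s, ‖φ s‖ ∂m := by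
  have hφ : Integrable φ m := (Lp.memLp φ).integrable (by norm_num)
  refine norm_integral_le_of_norm_le hφ.norm (.of_forall fun s => ?_)
  rw [norm_mul, Complex.norm_real]
  exact mul_le_of_le_one_left (norm_nonneg _) (abs_kernelK_le s t)

theorem memLp_kernelK_integral (φ : L2m) :
    MemLp (fun t : ℝ => ∫ s : ℝ, (kernelK s t : ℂ) * φ s ∂m) 2 m := by
  refine MemLp.of_bound ?_ (∫ s, ‖φ s‖ ∂m) (.of_forall (norm_kernelK_integral_le φ))
  refine StronglyMeasurable.aestronglyMeasurable ?_
  refine StronglyMeasurable.integral_prod_right' (f := fun q : ℝ × ℝ => (kernelK q.2 q.1 : ℂ) * φ q.2) ?_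
  refine StronglyMeasurable.mul ?_ ((Lp.stronglyMeasurable φ).comp_measurable measurable_snd)
  exact (Complex.measurable_ofReal.comp
      (measurable_kernelK.comp measurable_swap)).stronglyMeasurable

theorem integral_norm_le (φ : L2m) : ∫ s, ‖φ s‖ ∂m ≤ √(m.real univ) * ‖φ‖ := by
  have h := eLpNorm_le_eLpNorm_mul_rpow_measure_univ (p := 1) (q := 2) (μ := m) (by norm_num)
    (Lp.aestronglyMeasurable φ)
  rw [integral_norm_eq_lintegral_enorm (Lp.aestronglyMeasurable φ), ← eLpNorm_one_eq_lintegral_enorm]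
  have hfin : eLpNorm φ 2 m * m univ ^ (1 / (1 : ℝ≥0∞).toReal - 1 / (2 : ℝ≥0∞).toReal) ≠ ∞ := by
    refine ENNReal.mul_ne_top (Lp.eLpNorm_ne_top φ) ?_
    exact ENNReal.rpow_ne_top_of_nonneg (by norm_num) (measure_ne_top _ _)
  refine (ENNReal.toReal_mono hfin h).trans (le_of_eq ?_)
  rw [ENNReal.toReal_mul, ← ENNReal.toReal_rpow, Lp.norm_def, mul_comm, Real.sqrt_eq_rpow]
  norm_num [Measure.real]

/-- The integral operator `(𝓚φ)(t) = ∫ J₁(2√(st)) / √(st) φ(s) dm(s)` on `L₂(m)`. -/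
def opK : L2m →L[ℂ] L2m :=
  LinearMap.mkContinuous
    { toFun := fun φ => (memLp_kernelK_integral φ).toLp
      map_add' := fun φ ψ => by
        rw [← MemLp.toLp_add]
        refine MemLp.toLp_congr _ _ (.of_forall fun t => ?_)
        simp only [Pi.add_apply]
        rw [← integral_add (integrable_kernelK_mul φ t) (integrable_kernelK_mul ψ t)]
        refine integral_congr_ae ?_
        filter_upwards [Lp.coeFn_add φ ψ] with s hs
        rw [hs, Pi.add_apply, mul_add]
      map_smul' := fun c φ => by
        rw [RingHom.id_apply, ← MemLp.toLp_const_smul]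
        refine MemLp.toLp_congr _ _ (.of_forall fun t => ?_)
        simp only [Pi.smul_apply, smul_eq_mul]
        rw [← integral_const_mul]
        refine integral_congr_ae ?_
        filter_upwards [Lp.coeFn_smul c φ] with s hs
        rw [hs, Pi.smul_apply, smul_eq_mul]
        ring }
    (m.real univ)
    fun φ => by
      simp only [LinearMap.coe_mk, AddHom.coe_mk]
      have h1 : ∀ᵐ t ∂m, ‖(memLp_kernelK_integral φ).toLp _ t‖ ≤ ∫ s, ‖φ s‖ ∂m := by
        filter_upwards [(memLp_kernelK_integral φ).coeFn_toLp] with t ht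
        rw [ht]
        exact norm_kernelK_integral_le φ t
      have h2 := Lp.norm_le_of_ae_bound (integral_nonneg fun _ => norm_nonneg _) h1
      refine h2.trans ?_
      have h3 : ((measureUnivNNReal m : ℝ)) ^ (ENNReal.toReal 2)⁻¹ = √(m.real univ) := by
        rw [Real.sqrt_eq_rpow]
        norm_num [Measure.real, measureUnivNNReal]
        rfl
      calc _ ≤ √(m.real univ) * (√(m.real univ) * ‖φ‖) := by
            rw [h3]
            exact mul_le_mul_of_nonneg_left (integral_norm_le φ) (Real.sqrt_nonneg _)
        _ = m.real univ * ‖φ‖ := by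
            rw [← mul_assoc, Real.mul_self_sqrt measureReal_nonneg]

theorem opK_apply_ae (φ : L2m) :
    opK φ =ᵐ[m] fun t => ∫ s : ℝ, (kernelK s t : ℂ) * φ s ∂m :=
  (memLp_kernelK_integral φ).coeFn_toLp

theorem memLp_top_exp_neg : MemLp (fun t : ℝ => Complex.exp (-(t : ℂ))) ∞ m := by
  refine memLp_top_of_bound (by fun_prop) 1 ?_
  refine (withDensity_absolutelyContinuous _ _).ae_le ?_
  refine (ae_restrict_iff' measurableSet_Ioi).2 (.of_forall fun t ht => ?_)
  have ht : 0 < t := ht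
  rw [Complex.norm_exp]
  simpa using ht.le

/-- The multiplication operator `(Mφ)(t) = e^{-t} φ(t)` on `L₂(m)`. -/
def opM : L2m →L[ℂ] L2m :=
  (ContinuousLinearMap.mul ℂ ℂ).holderL m ∞ 2 2 memLp_top_exp_neg.toLp

theorem opM_apply_ae (φ : L2m) : opM φ =ᵐ[m] fun t => Complex.exp (-(t : ℂ)) * φ t := by
  refine ((ContinuousLinearMap.mul ℂ ℂ).coeFn_holder (r := 2) memLp_top_exp_neg.toLp φ).trans ?_
  filter_upwards [memLp_top_exp_neg.coeFn_toLp] with t ht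
  simp [ht]

/-- The operator `𝓚_z = z (1 - M) (1 - zM)⁻¹ 𝓚` on `L₂(m)`.  The inverse is taken in the algebra
of bounded operators; it exists for every `z` outside the ray `[1, ∞)`. -/
def opKz (z : ℂ) : L2m →L[ℂ] L2m :=
  z • ((1 - opM) * Ring.inverse (1 - z • opM) * opK)

/-- The inverse branch `Φ_n(w) = 1 / (w + n)` of the Gauss map; as a map of the half-plane into
itself it is defined for `n ≥ 1`, whence the shift of the index: `gaussBranch n = Φ_{n+1}`. -/
def gaussBranch (n : ℕ) (w : HalfPlane) : HalfPlane :=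
  ⟨1 / (w.1 + (n + 1 : ℕ)), by
    have h : 0 < (w.1 + (n + 1 : ℕ)).re := by
      have := w.2
      have hn : (0 : ℝ) ≤ n := n.cast_nonneg
      simp only [Complex.add_re, Complex.natCast_re]
      push_cast
      linarith
    have h2 : 0 ≤ (1 / (w.1 + (n + 1 : ℕ))).re := by
      rw [one_div, Complex.inv_re]
      exact div_nonneg h.le (Complex.normSq_nonneg _)
    linarith⟩

/-- `T` is the operator `𝓠_z` on `H₁`:
`(T f)(w) = ∑_{n ≥ 1} z^n (w + n)⁻² f(1 / (w + n))` for all `f ∈ H₁` and all `w`. -/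
def IsTransferOperator (z : ℂ) (T : H1 →L[ℂ] H1) : Prop :=
  ∀ (f : H1) (w : HalfPlane),
    HasSum (fun n : ℕ => z ^ (n + 1) * (1 / (w.1 + (n + 1 : ℕ))) ^ 2 * f (gaussBranch n w)) (T f w)

/-- The plane cut along the ray `[1, ∞)`. -/
def cutPlane : Set ℂ := {z | ∀ x : ℝ, 1 ≤ x → z ≠ x}

end FareyGauss

end

/-!
The Laplace transform `𝓛` intertwines `𝓚_z` with `𝓠_z`: for `|z| < 1` the geometric series of
`(1 - zM)⁻¹` turns `𝓚_z` into `∑ z^n (1 - M) M^(n-1) 𝓚`, and integrating the power series of the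
Bessel function against exponentials shows that `𝓛` carries the `n`-th summand to the `n`-th branch
`f ↦ (w + n)⁻² f(1 / (w + n))`. Conjugating `𝓚_z` by the isometry `𝓛` therefore continues `𝓠_z` to
the cut plane, where `1 - zM` stays invertible because `M` is multiplication by a function with
values in `[0, 1]`.

The kernel of `𝓚` is bounded and `m` is finite, so `𝓚` is Hilbert–Schmidt and each `𝓚_z` is compact.
Near a point `z₀`, a compact analytic family splits as an operator of norm less than `1` at `z₀`
plus a constant finite-rank one. Cramer's rule for the finite-rank part makes `(1 - 𝓠_z)⁻¹`
meromorphic, and it has a pole exactly where `1 - 𝓠_z` is not invertible.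

For `|z| < 1` an eigenvector of `𝓚_z` with eigenvalue `1` would give a fixed point `f` of `𝓠_z`.
On `[0, 1]` the operator `𝓠_z` contracts the norm `sup (1 + x) |f(x)|` by the factor `|z|`, so `f`
vanishes there, hence everywhere by analyticity.
-/

namespace FareyGauss

section Inverse

variable {𝕜 𝒜 : Type*} [NontriviallyNormedField 𝕜] [NormedRing 𝒜] [NormedAlgebra 𝕜 𝒜]
  {f : 𝕜 → 𝒜} {z₀ : 𝕜}

theorem analyticAt_ringInverse [HasSummableGeomSeries 𝒜] (hf : AnalyticAt 𝕜 f z₀)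
    (hu : IsUnit (f z₀)) : AnalyticAt 𝕜 (fun z => Ring.inverse (f z)) z₀ :=
  (analyticAt_inverse (𝕜 := 𝕜) hu.unit).comp_of_eq hf hu.unit_spec.symm

theorem isUnit_of_meromorphicOrderAt_ringInverse_nonneg (hf : AnalyticAt 𝕜 f z₀)
    (hmer : MeromorphicAt (fun z => Ring.inverse (f z)) z₀)
    (htop : meromorphicOrderAt (fun z => Ring.inverse (f z)) z₀ ≠ ⊤)
    (hord : 0 ≤ meromorphicOrderAt (fun z => Ring.inverse (f z)) z₀) : IsUnit (f z₀) := by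
  obtain ⟨S, hS⟩ := tendsto_nhds_of_meromorphicOrderAt_nonneg hmer hord
  have hc : Tendsto f (𝓝[≠] z₀) (𝓝 (f z₀)) := hf.continuousAt.tendsto.mono_left nhdsWithin_le_nhds
  have hev : ∀ᶠ z in 𝓝[≠] z₀, IsUnit (f z) := by
    filter_upwards [(meromorphicOrderAt_ne_top_iff_eventually_ne_zero hmer).1 htop] with z hz
    exact not_imp_comm.1 (Ring.inverse_non_unit _) hz
  have hright : f z₀ * S = 1 := tendsto_nhds_unique (hc.mul hS) <|
    tendsto_const_nhds.congr' <| hev.mono fun z hz => (Ring.mul_inverse_cancel _ hz).symm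
  have hleft : S * f z₀ = 1 := tendsto_nhds_unique (hS.mul hc) <|
    tendsto_const_nhds.congr' <| hev.mono fun z hz => (Ring.inverse_mul_cancel _ hz).symm
  exact ⟨⟨_, _, hright, hleft⟩, rfl⟩

theorem meromorphicOrderAt_ringInverse_neg_iff [HasSummableGeomSeries 𝒜] (hf : AnalyticAt 𝕜 f z₀)
    (hmer : MeromorphicAt (fun z => Ring.inverse (f z)) z₀)
    (htop : meromorphicOrderAt (fun z => Ring.inverse (f z)) z₀ ≠ ⊤) :
    meromorphicOrderAt (fun z => Ring.inverse (f z)) z₀ < 0 ↔ ¬ IsUnit (f z₀) := by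
  refine ⟨fun h hu => h.not_ge (analyticAt_ringInverse hf hu).meromorphicOrderAt_nonneg, ?_⟩
  contrapose!
  exact isUnit_of_meromorphicOrderAt_ringInverse_nonneg hf hmer htop

theorem meromorphicAt_mul_analyticAt {g : 𝕜 → 𝒜} (hf : MeromorphicAt f z₀)
    (hg : AnalyticAt 𝕜 g z₀) : MeromorphicAt (fun z => f z * g z) z₀ := by
  obtain ⟨n, hn⟩ := hf
  exact ⟨n, by simpa only [smul_mul_assoc] using hn.fun_mul hg⟩

end Inverse

theorem ringInverse_map_mulEquiv {R S F : Type*} [MonoidWithZero R] [MonoidWithZero S]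
    [EquivLike F R S] [MulEquivClass F R S] (e : F) (a : R) :
    Ring.inverse (e a) = e (Ring.inverse a) := by
  by_cases ha : IsUnit a
  · rw [← mul_one (Ring.inverse (e a)), Ring.inverse_mul_eq_iff_eq_mul _ _ _ (ha.map e), ← map_mul,
      Ring.mul_inverse_cancel _ ha, map_one]
  · rw [Ring.inverse_non_unit _ ha, map_zero, Ring.inverse_non_unit]
    rwa [MulEquiv.isUnit_map]

section Matrix

variable {𝕜 ι : Type*} [NontriviallyNormedField 𝕜] [Fintype ι] [DecidableEq ι]
  {M : 𝕜 → Matrix ι ι 𝕜} {z₀ : 𝕜}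

theorem analyticAt_matrix_det (hM : ∀ i j, AnalyticAt 𝕜 (fun z => M z i j) z₀) :
    AnalyticAt 𝕜 (fun z => (M z).det) z₀ := by
  simp only [Matrix.det_apply']
  exact Finset.analyticAt_fun_sum _ fun σ _ => analyticAt_const.mul
    (Finset.analyticAt_fun_prod _ fun i _ => hM _ _)

theorem analyticAt_matrix_adjugate (hM : ∀ i j, AnalyticAt 𝕜 (fun z => M z i j) z₀) (i j : ι) :
    AnalyticAt 𝕜 (fun z => (M z).adjugate i j) z₀ := by
  simp only [Matrix.adjugate_apply]
  refine analyticAt_matrix_det fun k l => ?_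
  simp only [Matrix.updateRow_apply]
  split_ifs
  exacts [analyticAt_const, hM k l]

end Matrix

section FiniteDimensional

variable {𝕜 V : Type*} [NontriviallyNormedField 𝕜] [CompleteSpace 𝕜] [NormedAddCommGroup V]
  [NormedSpace 𝕜 V] [FiniteDimensional 𝕜 V]

theorem analyticAt_toMatrix {D : 𝕜 → V →L[𝕜] V} {z₀ : 𝕜} (hD : AnalyticAt 𝕜 D z₀)
    {ι : Type*} [Fintype ι] [DecidableEq ι] (b : Module.Basis ι 𝕜 V) (i j : ι) :
    AnalyticAt 𝕜 (fun z => LinearMap.toMatrix b b (D z : V →ₗ[𝕜] V) i j) z₀ := by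
  simp only [LinearMap.toMatrix_apply]
  exact (((b.coord i).toContinuousLinearMap ∘L ContinuousLinearMap.apply 𝕜 V (b j)).analyticAt
    _).comp_of_eq hD rfl

theorem analyticAt_clm_det {D : 𝕜 → V →L[𝕜] V} {z₀ : 𝕜} (hD : AnalyticAt 𝕜 D z₀) :
    AnalyticAt 𝕜 (fun z => (D z).det) z₀ := by
  simp only [ContinuousLinearMap.det, ← LinearMap.det_toMatrix (Module.finBasis 𝕜 V)]
  exact analyticAt_matrix_det (analyticAt_toMatrix hD _)

theorem isUnit_clm_iff_det_ne_zero (D : V →L[𝕜] V) : IsUnit D ↔ D.det ≠ 0 := by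
  rw [← isUnit_iff_ne_zero, ContinuousLinearMap.det, ← LinearMap.isUnit_iff_isUnit_det]
  exact (MulEquiv.isUnit_map (Module.End.toContinuousLinearMap V).symm).symm

theorem exists_analyticAt_ringInverse_eq_inv_det_smul {D : 𝕜 → V →L[𝕜] V} {z₀ : 𝕜}
    (hD : AnalyticAt 𝕜 D z₀) : ∃ G : 𝕜 → V →L[𝕜] V, AnalyticAt 𝕜 G z₀ ∧
      ∀ z, Ring.inverse (D z) = (D z).det⁻¹ • G z := by
  let b := Module.finBasis 𝕜 V
  let φ := (LinearMap.toMatrixAlgEquiv b).symm.trans (Module.End.toContinuousLinearMap V)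
  let M : 𝕜 → Matrix _ _ 𝕜 := fun z => LinearMap.toMatrix b b (D z)
  have hφ : ∀ z, φ (M z) = D z := fun z =>
    φ.symm.injective (by rw [AlgEquiv.symm_apply_apply]; rfl)
  refine ⟨fun z => ∑ i, ∑ j, (M z).adjugate i j • φ (Matrix.single i j 1), ?_, fun z => ?_⟩
  · exact Finset.analyticAt_fun_sum _ fun i _ => Finset.analyticAt_fun_sum _ fun j _ =>
      (analyticAt_matrix_adjugate (analyticAt_toMatrix hD b) i j).smul analyticAt_const
  · rw [ContinuousLinearMap.det, ← LinearMap.det_toMatrix b, ← hφ z, ringInverse_map_mulEquiv,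
      ← Matrix.nonsing_inv_eq_ringInverse, Matrix.inv_def, Ring.inverse_eq_inv, map_smul, hφ z]
    conv_lhs => rw [Matrix.matrix_eq_sum_single (M z).adjugate]
    simp only [map_sum, ← map_smul, Matrix.smul_single, smul_eq_mul, mul_one]
    rfl

end FiniteDimensional

section FactorThrough

variable {𝕜 E V : Type*} [NontriviallyNormedField 𝕜] [NormedAddCommGroup E] [NormedSpace 𝕜 E]
  [NormedAddCommGroup V] [NormedSpace 𝕜 V]

theorem one_sub_comp_mul_one_add_inverse {X : V →L[𝕜] E} {Y : E →L[𝕜] V}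
    (h : IsUnit (1 - Y ∘L X)) :
    (1 - X ∘L Y) * (1 + X ∘L Ring.inverse (1 - Y ∘L X) ∘L Y) = 1 := by
  ext x
  have hx := congrArg X (DFunLike.congr_fun (Ring.mul_inverse_cancel _ h) (Y x))
  simp only [mul_apply_eq_comp, sub_apply, one_apply_eq_self, ContinuousLinearMap.comp_apply,
    map_sub, add_apply, map_add] at hx ⊢
  linear_combination (norm := module) hx

theorem one_add_inverse_mul_one_sub_comp {X : V →L[𝕜] E} {Y : E →L[𝕜] V}
    (h : IsUnit (1 - Y ∘L X)) :
    (1 + X ∘L Ring.inverse (1 - Y ∘L X) ∘L Y) * (1 - X ∘L Y) = 1 := by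
  ext x
  have hx := congrArg X (DFunLike.congr_fun (Ring.inverse_mul_cancel _ h) (Y x))
  simp only [mul_apply_eq_comp, sub_apply, one_apply_eq_self, ContinuousLinearMap.comp_apply,
    map_sub, add_apply] at hx ⊢
  linear_combination (norm := module) hx

theorem isUnit_one_sub_comp {X : V →L[𝕜] E} {Y : E →L[𝕜] V} (h : IsUnit (1 - Y ∘L X)) :
    IsUnit (1 - X ∘L Y) :=
  ⟨⟨_, _, one_sub_comp_mul_one_add_inverse h, one_add_inverse_mul_one_sub_comp h⟩, rfl⟩

theorem isUnit_one_sub_comp_comm (X : V →L[𝕜] E) (Y : E →L[𝕜] V) :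
    IsUnit (1 - X ∘L Y) ↔ IsUnit (1 - Y ∘L X) :=
  ⟨isUnit_one_sub_comp, isUnit_one_sub_comp⟩

theorem ringInverse_one_sub_comp {X : V →L[𝕜] E} {Y : E →L[𝕜] V} (h : IsUnit (1 - Y ∘L X)) :
    Ring.inverse (1 - X ∘L Y) = 1 + X ∘L Ring.inverse (1 - Y ∘L X) ∘L Y := by
  rw [← mul_one (Ring.inverse _), Ring.inverse_mul_eq_iff_eq_mul _ _ _ (isUnit_one_sub_comp h),
    one_sub_comp_mul_one_add_inverse h]

theorem meromorphicAt_ringInverse_one_sub_comp [CompleteSpace 𝕜] [FiniteDimensional 𝕜 V]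
    {X : 𝕜 → V →L[𝕜] E} {z₀ : 𝕜} (hX : AnalyticAt 𝕜 X z₀) (Y : E →L[𝕜] V) :
    MeromorphicAt (fun z => Ring.inverse (1 - X z ∘L Y)) z₀ := by
  have hD : AnalyticAt 𝕜 (fun z => 1 - Y ∘L X z) z₀ :=
    analyticAt_const.sub (((ContinuousLinearMap.compL 𝕜 V E V Y).analyticAt _).comp_of_eq hX rfl)
  obtain ⟨G, hG, hinv⟩ := exists_analyticAt_ringInverse_eq_inv_det_smul hD
  have hdet := analyticAt_clm_det hD
  have hsandwich : AnalyticAt 𝕜 (fun z => X z ∘L G z ∘L Y) z₀ :=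
    ((ContinuousLinearMap.compL 𝕜 E V E).analyticAt_bilinear _).comp₂ hX <|
      (((ContinuousLinearMap.compL 𝕜 E V V).flip Y).analyticAt _).comp_of_eq hG rfl
  refine (hdet.meromorphicAt.inv.smul
    ((hdet.smul (analyticAt_const (v := (1 : E →L[𝕜] E)))).add hsandwich).meromorphicAt).congr
    (.of_forall fun z => ?_)
  by_cases h : IsUnit (1 - Y ∘L X z)
  · have hd := (isUnit_clm_iff_det_ne_zero _).1 h
    simp [ringInverse_one_sub_comp h, hinv z, inv_smul_smul₀ hd]
  · have hd := not_ne_iff.1 (mt (isUnit_clm_iff_det_ne_zero _).2 h)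
    simp [hd, Ring.inverse_non_unit _ (mt (isUnit_one_sub_comp_comm _ _).1 h)]

theorem meromorphicAt_ringInverse_sub_comp [CompleteSpace 𝕜] [CompleteSpace E]
    [FiniteDimensional 𝕜 V] {A : 𝕜 → E →L[𝕜] E} {z₀ : 𝕜} (hA : AnalyticAt 𝕜 A z₀)
    (hu : IsUnit (A z₀)) (B : V →L[𝕜] E) (C : E →L[𝕜] V) :
    MeromorphicAt (fun z => Ring.inverse (A z - B ∘L C)) z₀ := by
  have hR := analyticAt_ringInverse hA hu
  have hX : AnalyticAt 𝕜 (fun z => Ring.inverse (A z) ∘L B) z₀ :=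
    (((ContinuousLinearMap.compL 𝕜 V E E).flip B).analyticAt _).comp_of_eq hR rfl
  refine (meromorphicAt_mul_analyticAt (meromorphicAt_ringInverse_one_sub_comp hX C) hR).congr ?_
  filter_upwards [(hA.continuousAt.eventually (Units.isOpen.mem_nhds hu)).filter_mono
    nhdsWithin_le_nhds] with z hz
  have hfactor : A z - B ∘L C = A z * (1 - (Ring.inverse (A z) ∘L B) ∘L C) := by
    rw [mul_sub, mul_one, ContinuousLinearMap.comp_assoc, ← ContinuousLinearMap.mul_def,
      Ring.mul_inverse_cancel_left _ _ hz]
  rw [hfactor, Ring.inverse_mul (.inl hz)]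

end FactorThrough

theorem isUnit_one_sub_iff_not_hasEigenvalue {𝕜 E : Type*} [NontriviallyNormedField 𝕜]
    [NormedAddCommGroup E] [NormedSpace 𝕜 E] [CompleteSpace E] {T : E →L[𝕜] E}
    (hT : IsCompactOperator T) :
    IsUnit (1 - T) ↔ ¬ Module.End.HasEigenvalue (T : E →ₗ[𝕜] E) 1 := by
  rw [hT.hasEigenvalue_iff_mem_spectrum one_ne_zero, spectrum.notMem_iff, map_one]

section Fredholm

variable {𝕜 E : Type*} [RCLike 𝕜] [NormedAddCommGroup E] [InnerProductSpace 𝕜 E]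

theorem exists_finiteDimensional_norm_sub_starProjection_comp_le {F : Type*}
    [SeminormedAddCommGroup F] [NormedSpace 𝕜 F] {T : F →L[𝕜] E} (hT : IsCompactOperator T) {ε : ℝ}
    (hε : 0 < ε) : ∃ (V : Submodule 𝕜 E) (_ : FiniteDimensional 𝕜 V),
      ‖T - V.starProjection ∘L T‖ ≤ ε := by
  obtain ⟨K, hK, hTK⟩ := hT.image_closedBall_subset_compact 1
  obtain ⟨s, -, hs, hcover⟩ := hK.finite_cover_balls hε
  have hfin : FiniteDimensional 𝕜 (Submodule.span 𝕜 s) := .span_of_finite 𝕜 hs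
  refine ⟨.span 𝕜 s, hfin, ContinuousLinearMap.opNorm_le_of_unit_norm hε.le fun x hx => ?_⟩
  obtain ⟨y, hy, hxy⟩ := mem_iUnion₂.1 (hcover (hTK ⟨x, by simp [hx], rfl⟩))
  rw [sub_apply, ContinuousLinearMap.comp_apply, Submodule.starProjection_minimal]
  refine (ciInf_le ⟨0, ?_⟩ ⟨y, Submodule.subset_span hy⟩).trans (mem_ball_iff_norm.1 hxy).le
  exact forall_mem_range.2 fun _ => norm_nonneg _

variable [CompleteSpace E]

theorem meromorphicAt_ringInverse_one_sub {T : 𝕜 → E →L[𝕜] E} {z₀ : 𝕜} (hT : AnalyticAt 𝕜 T z₀)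
    (hc : IsCompactOperator (T z₀)) : MeromorphicAt (fun z => Ring.inverse (1 - T z)) z₀ := by
  obtain ⟨V, _, hV⟩ := exists_finiteDimensional_norm_sub_starProjection_comp_le hc one_half_pos
  have hu : IsUnit (1 - (T z₀ - V.starProjection ∘L T z₀)) :=
    isUnit_one_sub_of_norm_lt_one (hV.trans_lt one_half_lt_one)
  refine (meromorphicAt_ringInverse_sub_comp (analyticAt_const.sub (hT.sub analyticAt_const)) hu
    V.subtypeL (V.orthogonalProjectionOnto ∘L T z₀)).congr (.of_forall fun z => ?_)
  change Ring.inverse (1 - (T z - V.starProjection ∘L T z₀) - V.starProjection ∘L T z₀) = _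
  rw [← sub_add, add_sub_cancel_right]

theorem meromorphicOrderAt_ringInverse_one_sub_ne_top [Nontrivial E] {T : 𝕜 → E →L[𝕜] E}
    {U : Set 𝕜} (hU : IsPreconnected U) (hT : AnalyticOnNhd 𝕜 T U)
    (hc : ∀ z ∈ U, IsCompactOperator (T z)) {z₀ : 𝕜} (hz₀ : z₀ ∈ U) (hu : IsUnit (1 - T z₀))
    {z : 𝕜} (hz : z ∈ U) :
    meromorphicOrderAt (fun z => Ring.inverse (1 - T z)) z ≠ ⊤ := by
  have hmer : MeromorphicOn (fun z => Ring.inverse (1 - T z)) U := fun w hw =>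
    meromorphicAt_ringInverse_one_sub (hT w hw) (hc w hw)
  refine hmer.meromorphicOrderAt_ne_top_of_isPreconnected hU hz₀ hz ?_
  rw [meromorphicOrderAt_ne_top_iff_eventually_ne_zero (hmer z₀ hz₀)]
  have hev := (analyticAt_const.sub (hT z₀ hz₀)).continuousAt.eventually (Units.isOpen.mem_nhds hu)
  filter_upwards [hev.filter_mono nhdsWithin_le_nhds] with w hw
  exact Ring.isUnit_iff_inverse_ne_zero.1 hw

end Fredholm

section HilbertSchmidt

variable {𝕜 E F ι : Type*} [RCLike 𝕜] [NormedAddCommGroup E] [InnerProductSpace 𝕜 E]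

theorem norm_sum_inner_smul_le [SeminormedAddCommGroup F] [NormedSpace 𝕜 F] {b : ι → E}
    (hb : Orthonormal 𝕜 b) (y : ι → F) (s : Finset ι) (x : E) :
    ‖∑ i ∈ s, inner 𝕜 (b i) x • y i‖ ≤ √(∑ i ∈ s, ‖y i‖ ^ 2) * ‖x‖ :=
  calc ‖∑ i ∈ s, inner 𝕜 (b i) x • y i‖ ≤ ∑ i ∈ s, ‖inner 𝕜 (b i) x‖ * ‖y i‖ :=
        norm_sum_le_of_le _ fun i _ => (norm_smul _ _).le
    _ ≤ √(∑ i ∈ s, ‖inner 𝕜 (b i) x‖ ^ 2) * √(∑ i ∈ s, ‖y i‖ ^ 2) :=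
        Real.sum_mul_le_sqrt_mul_sqrt _ _ _
    _ ≤ ‖x‖ * √(∑ i ∈ s, ‖y i‖ ^ 2) := by
        gcongr
        exact Real.sqrt_le_iff.2 ⟨norm_nonneg x, hb.sum_inner_products_le x⟩
    _ = √(∑ i ∈ s, ‖y i‖ ^ 2) * ‖x‖ := mul_comm _ _

variable [NormedAddCommGroup F] [NormedSpace 𝕜 F]

theorem isCompactOperator_sum_smulRight (s : Finset ι) (e : ι → E →L[𝕜] 𝕜) (y : ι → F) :
    IsCompactOperator (∑ i ∈ s, (e i).smulRight (y i) : E →L[𝕜] F) := by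
  refine (compactOperator (RingHom.id 𝕜) E F).sum_mem fun i _ => ?_
  exact (isCompactOperator_of_locallyCompactSpace_rng
    (ContinuousLinearMap.toSpanSingleton 𝕜 (y i))).comp_clm (e i)

theorem isCompactOperator_of_summable_norm_sq [CompleteSpace F] (b : HilbertBasis ι 𝕜 E)
    {T : E →L[𝕜] F} (hT : Summable fun i => ‖T (b i)‖ ^ 2) : IsCompactOperator T := by
  classical
  let S : Finset ι → E →L[𝕜] F := fun s => ∑ i ∈ s, (innerSL 𝕜 (b i)).smulRight (T (b i))
  have hS : ∀ s x, S s x = ∑ i ∈ s, inner 𝕜 (b i) x • T (b i) := fun s x => by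
    simp [S, sum_apply]
  have hpointwise : ∀ x, Tendsto (fun s => S s x) atTop (𝓝 (T x)) := fun x => by
    simpa [HasSum, hS, b.repr_apply_apply] using T.hasSum (b.hasSum_repr x)
  refine isCompactOperator_of_tendsto (l := atTop) (F := S) (Metric.tendsto_nhds.2 fun ε hε => ?_)
    (.of_forall fun s => isCompactOperator_sum_smulRight s _ _)
  obtain ⟨s, hs⟩ := summable_iff_vanishing_norm.1 hT ((ε / 2) ^ 2) (by positivity)
  filter_upwards [eventually_ge_atTop s] with s' hs'
  refine (?_ : _ ≤ ε / 2).trans_lt (half_lt_self hε)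
  rw [dist_eq_norm]
  refine ContinuousLinearMap.opNorm_le_bound _ (by positivity) fun x => ?_
  refine le_of_tendsto ((hpointwise x).const_sub (S s' x)).norm ?_
  filter_upwards [eventually_ge_atTop s'] with t ht
  rw [hS, hS, norm_sub_rev, ← Finset.sum_sdiff ht, add_sub_cancel_right]
  refine (norm_sum_inner_smul_le b.orthonormal _ _ x).trans ?_
  gcongr
  refine Real.sqrt_le_iff.2 ⟨by positivity, (le_abs_self _).trans (hs (t \ s') ?_).le⟩
  exact Finset.sdiff_disjoint.mono_right hs'

theorem norm_sq_eq_integral {α : Type*} [MeasurableSpace α] {μ : Measure α} (φ : Lp 𝕜 2 μ) :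
    ‖φ‖ ^ 2 = ∫ t, ‖φ t‖ ^ 2 ∂μ := by
  rw [norm_sq_eq_re_inner (𝕜 := 𝕜), L2.inner_def, ← integral_re (L2.integrable_inner _ _)]
  simp only [← norm_sq_eq_re_inner]

theorem summable_norm_sq_of_inner_kernel {α : Type*} [MeasurableSpace α] {μ : Measure α}
    {T : E →L[𝕜] Lp 𝕜 2 μ} {κ : α → E} (hT : ∀ x, T x =ᵐ[μ] fun t => inner 𝕜 (κ t) x)
    {g : α → ℝ} (hg : Integrable g μ) (hκ : ∀ᵐ t ∂μ, ‖κ t‖ ^ 2 ≤ g t) {b : ι → E}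
    (hb : Orthonormal 𝕜 b) : Summable fun i => ‖T (b i)‖ ^ 2 := by
  refine summable_of_sum_le (c := ∫ t, g t ∂μ) (fun _ => by positivity) fun s => ?_
  have hint : ∀ i ∈ s, Integrable (fun t => ‖T (b i) t‖ ^ 2) μ := fun i _ =>
    (memLp_two_iff_integrable_sq_norm (Lp.aestronglyMeasurable _)).1 (Lp.memLp _)
  simp only [norm_sq_eq_integral]
  rw [← integral_finsetSum _ hint]
  refine integral_mono_ae (integrable_finsetSum _ hint) hg ?_
  filter_upwards [(Finset.eventually_all s).2 fun i _ => hT (b i), hκ] with t ht hκt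
  calc ∑ i ∈ s, ‖T (b i) t‖ ^ 2 = ∑ i ∈ s, ‖inner 𝕜 (b i) (κ t)‖ ^ 2 :=
        Finset.sum_congr rfl fun i hi => by rw [ht i hi, norm_inner_symm]
    _ ≤ ‖κ t‖ ^ 2 := hb.sum_inner_products_le _
    _ ≤ g t := hκt

theorem isCompactOperator_of_inner_kernel [CompleteSpace E] {α : Type*} [MeasurableSpace α]
    {μ : Measure α} {T : E →L[𝕜] Lp 𝕜 2 μ} {κ : α → E}
    (hT : ∀ x, T x =ᵐ[μ] fun t => inner 𝕜 (κ t) x) {g : α → ℝ} (hg : Integrable g μ)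
    (hκ : ∀ᵐ t ∂μ, ‖κ t‖ ^ 2 ≤ g t) : IsCompactOperator T := by
  obtain ⟨_, b, -⟩ := exists_hilbertBasis 𝕜 E
  exact isCompactOperator_of_summable_norm_sq b
    (summable_norm_sq_of_inner_kernel hT hg hκ b.orthonormal)

end HilbertSchmidt

section Multiplication

variable {α 𝕜 : Type*} [MeasurableSpace α] {μ : Measure α} [RCLike 𝕜] {p : ℝ≥0∞} [Fact (1 ≤ p)]

/-- `T` is the multiplication operator on `Lᵖ(μ)` with symbol `g`. As a relation, it applies to
operators that are given by an algebraic expression. -/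
def IsMultiplicationBy (T : Lp 𝕜 p μ →L[𝕜] Lp 𝕜 p μ) (g : α → 𝕜) : Prop :=
  ∀ φ : Lp 𝕜 p μ, T φ =ᵐ[μ] fun x => g x * φ x

theorem exists_isMultiplicationBy {g : α → 𝕜} (hg : MemLp g ∞ μ) :
    ∃ T : Lp 𝕜 p μ →L[𝕜] Lp 𝕜 p μ, IsMultiplicationBy T g := by
  refine ⟨(ContinuousLinearMap.mul 𝕜 𝕜).holderL μ ∞ p p hg.toLp, fun φ => ?_⟩
  refine ((ContinuousLinearMap.mul 𝕜 𝕜).coeFn_holder (r := p) hg.toLp φ).trans ?_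
  filter_upwards [hg.coeFn_toLp] with x hx
  rw [hx, ContinuousLinearMap.mul_apply']

namespace IsMultiplicationBy

variable {S T : Lp 𝕜 p μ →L[𝕜] Lp 𝕜 p μ} {f g : α → 𝕜}

theorem one : IsMultiplicationBy (1 : Lp 𝕜 p μ →L[𝕜] Lp 𝕜 p μ) 1 := fun φ =>
  .of_forall fun x => (one_mul (φ x)).symm

theorem sub (hS : IsMultiplicationBy S f) (hT : IsMultiplicationBy T g) :
    IsMultiplicationBy (S - T) (f - g) := fun φ => by
  filter_upwards [Lp.coeFn_sub (S φ) (T φ), hS φ, hT φ] with x hx hSx hTx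
  rw [sub_apply, hx, Pi.sub_apply, hSx, hTx, Pi.sub_apply, sub_mul]

theorem const_smul (hT : IsMultiplicationBy T g) (c : 𝕜) :
    IsMultiplicationBy (c • T) (c • g) := fun φ => by
  filter_upwards [Lp.coeFn_smul c (T φ), hT φ] with x hx hTx
  rw [smul_apply, hx, Pi.smul_apply, hTx, Pi.smul_apply, smul_mul_assoc]

theorem mul (hS : IsMultiplicationBy S f) (hT : IsMultiplicationBy T g) :
    IsMultiplicationBy (S * T) (f * g) := fun φ => by
  filter_upwards [hS (T φ), hT φ] with x hSx hTx
  rw [mul_apply_eq_comp, hSx, hTx, Pi.mul_apply, mul_assoc]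

theorem pow (hT : IsMultiplicationBy T g) (n : ℕ) : IsMultiplicationBy (T ^ n) (g ^ n) := by
  induction n with
  | zero => simpa only [pow_zero] using one
  | succ n ih => simpa only [pow_succ] using ih.mul hT

theorem eq_of_ae_eq (hS : IsMultiplicationBy S f) (hT : IsMultiplicationBy T g)
    (h : f =ᵐ[μ] g) : S = T := by
  ext φ
  filter_upwards [hS φ, hT φ, h] with x hSx hTx hx
  rw [hSx, hTx, hx]

theorem norm_le (hT : IsMultiplicationBy T g) {C : ℝ} (hC : 0 ≤ C) (hg : ∀ᵐ x ∂μ, ‖g x‖ ≤ C) :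
    ‖T‖ ≤ C := by
  refine ContinuousLinearMap.opNorm_le_bound _ hC fun φ => Lp.norm_le_mul_norm_of_ae_le_mul ?_
  filter_upwards [hT φ, hg] with x hTx hx
  rw [hTx, norm_mul]
  gcongr

theorem isUnit (hT : IsMultiplicationBy T g) (hgm : AEStronglyMeasurable g μ) {δ : ℝ}
    (hδ : 0 < δ) (hg : ∀ᵐ x ∂μ, δ ≤ ‖g x‖) : IsUnit T := by
  have hbdd : MemLp g⁻¹ ∞ μ := by
    refine memLp_top_of_bound hgm.inv₀ δ⁻¹ (hg.mono fun x hx => ?_)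
    rw [Pi.inv_apply, norm_inv]
    exact inv_anti₀ hδ hx
  have hne : ∀ᵐ x ∂μ, g x ≠ 0 := hg.mono fun x hx => norm_pos_iff.1 (hδ.trans_le hx)
  obtain ⟨R, hR⟩ := exists_isMultiplicationBy (p := p) hbdd
  refine ⟨⟨T, R, (hT.mul hR).eq_of_ae_eq one ?_, (hR.mul hT).eq_of_ae_eq one ?_⟩, rfl⟩
  · exact hne.mono fun x hx => mul_inv_cancel₀ hx
  · exact hne.mono fun x hx => inv_mul_cancel₀ hx

end IsMultiplicationBy

end Multiplication

section Operators

theorem ae_m_of_forall_pos {p : ℝ → Prop} (h : ∀ t, 0 < t → p t) : ∀ᵐ t ∂m, p t :=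
  (withDensity_absolutelyContinuous _ _).ae_le (ae_restrict_of_forall_mem measurableSet_Ioi h)

theorem memLp_kernelK (t : ℝ) : MemLp (fun s => (kernelK s t : ℂ)) 2 m := by
  refine MemLp.of_bound ?_ 1 (.of_forall fun s => ?_)
  · exact (Complex.measurable_ofReal.comp
      (measurable_kernelK.comp (measurable_id.prodMk measurable_const))).aestronglyMeasurable
  · rw [Complex.norm_real]
    exact abs_kernelK_le s t

theorem inner_toLp_kernelK (φ : L2m) (t : ℝ) :
    inner ℂ (memLp_kernelK t).toLp φ = ∫ s : ℝ, (kernelK s t : ℂ) * φ s ∂m := by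
  rw [L2.inner_def]
  refine integral_congr_ae ?_
  filter_upwards [(memLp_kernelK t).coeFn_toLp] with s hs
  rw [hs, RCLike.inner_apply, Complex.conj_ofReal, mul_comm]

theorem norm_toLp_kernelK_sq_le (t : ℝ) : ‖(memLp_kernelK t).toLp‖ ^ 2 ≤ m.real univ := by
  have h : ∀ᵐ s ∂m, ‖(memLp_kernelK t).toLp _ s‖ ≤ 1 := by
    filter_upwards [(memLp_kernelK t).coeFn_toLp] with s hs
    rw [hs, Complex.norm_real]
    exact abs_kernelK_le s t
  calc ‖(memLp_kernelK t).toLp‖ ^ 2 = ∫ s, ‖(memLp_kernelK t).toLp _ s‖ ^ 2 ∂m :=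
        norm_sq_eq_integral _
    _ ≤ ∫ _, (1 : ℝ) ∂m :=
        integral_mono_of_nonneg (.of_forall fun _ => by positivity) (integrable_const _)
          (h.mono fun s hs => pow_le_one₀ (norm_nonneg _) hs)
    _ = m.real univ := by rw [integral_const, smul_eq_mul, mul_one]

theorem isCompactOperator_opK : IsCompactOperator opK := by
  refine isCompactOperator_of_inner_kernel (κ := fun t => (memLp_kernelK t).toLp)
    (fun φ => ?_) (integrable_const (m.real univ)) (.of_forall norm_toLp_kernelK_sq_le)
  filter_upwards [opK_apply_ae φ] with t ht
  rw [ht, inner_toLp_kernelK]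

theorem isCompactOperator_opKz (z : ℂ) : IsCompactOperator (opKz z) := by
  rw [opKz, ← smul_mul_assoc]
  exact isCompactOperator_opK.clm_comp (z • ((1 - opM) * Ring.inverse (1 - z • opM)))

theorem isMultiplicationBy_opM :
    IsMultiplicationBy opM fun t : ℝ => Complex.exp (-(t : ℂ)) :=
  opM_apply_ae

theorem norm_opM_le : ‖opM‖ ≤ 1 := by
  refine isMultiplicationBy_opM.norm_le zero_le_one (ae_m_of_forall_pos fun t ht => ?_)
  rw [Complex.norm_exp, Real.exp_le_one_iff, Complex.neg_re, Complex.ofReal_re, neg_nonpos]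
  exact ht.le

theorem exists_le_norm_one_sub_mul {z : ℂ} (hz : z ∈ cutPlane) :
    ∃ δ > 0, ∀ x ∈ Icc (0 : ℝ) 1, δ ≤ ‖1 - z * x‖ := by
  obtain ⟨x₀, hx₀, hmin⟩ := isCompact_Icc.exists_isMinOn (nonempty_Icc.2 (zero_le_one' ℝ))
    (f := fun x : ℝ => ‖1 - z * x‖) (by fun_prop)
  refine ⟨_, norm_pos_iff.2 fun h => ?_, fun x hx => hmin hx⟩
  have h1 : z * x₀ = 1 := (sub_eq_zero.1 h).symm
  have h0 : x₀ ≠ 0 := by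
    rintro rfl
    rw [Complex.ofReal_zero, mul_zero] at h1
    exact zero_ne_one h1
  have hpos : 0 < x₀ := hx₀.1.lt_of_ne' h0
  refine hz x₀⁻¹ ((one_le_inv₀ hpos).2 hx₀.2) ?_
  rw [Complex.ofReal_inv]
  exact eq_inv_of_mul_eq_one_left h1

theorem isUnit_one_sub_smul_opM {z : ℂ} (hz : z ∈ cutPlane) : IsUnit (1 - z • opM) := by
  obtain ⟨δ, hδ, hle⟩ := exists_le_norm_one_sub_mul hz
  refine (IsMultiplicationBy.one.sub (isMultiplicationBy_opM.const_smul z)).isUnit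
    (by fun_prop) hδ (ae_m_of_forall_pos fun t ht => ?_)
  have h := hle (Real.exp (-t)) ⟨(Real.exp_pos _).le, Real.exp_le_one_iff.2 (neg_nonpos.2 ht.le)⟩
  rwa [Complex.ofReal_exp, Complex.ofReal_neg] at h

theorem analyticAt_opKz {z : ℂ} (hz : z ∈ cutPlane) : AnalyticAt ℂ opKz z := by
  have hinv : AnalyticAt ℂ (fun z : ℂ => Ring.inverse (1 - z • opM)) z :=
    analyticAt_ringInverse (analyticAt_const.sub (analyticAt_id.smul analyticAt_const))
      (isUnit_one_sub_smul_opM hz)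
  exact analyticAt_id.smul ((analyticAt_const.mul hinv).mul analyticAt_const)

theorem hasSum_opKz {z : ℂ} (hz : ‖z‖ < 1) :
    HasSum (fun n : ℕ => z ^ (n + 1) • ((1 - opM) * opM ^ n * opK)) (opKz z) := by
  have hlt : ‖z • opM‖ < 1 := by
    rw [norm_smul]
    exact (mul_le_of_le_one_right (norm_nonneg _) norm_opM_le).trans_lt hz
  have hgeom : HasSum (fun n : ℕ => (z • opM) ^ n) (Ring.inverse (1 - z • opM)) := by
    rw [NormedRing.inverse_one_sub _ hlt]
    exact (summable_geometric_of_norm_lt_one hlt).hasSum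
  refine (((hgeom.mul_left (1 - opM)).mul_right opK).const_smul z).congr_fun fun n => ?_
  rw [smul_pow, mul_smul_comm, smul_mul_assoc, smul_smul, pow_succ']

end Operators

section LaplaceBessel

theorem norm_pow_mul_cexp (n : ℕ) (u : ℂ) {t : ℝ} (ht : 0 ≤ t) :
    ‖(t : ℂ) ^ n * Complex.exp (-u * t)‖ = t ^ n * Real.exp (-(u.re * t)) := by
  rw [norm_mul, norm_pow, Complex.norm_real, Complex.norm_exp, Real.norm_of_nonneg ht,
    Complex.re_mul_ofReal, Complex.neg_re, neg_mul]

theorem integrableOn_pow_mul_cexp (n : ℕ) {u : ℂ} (hu : 0 < u.re) :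
    IntegrableOn (fun t : ℝ => (t : ℂ) ^ n * Complex.exp (-u * t)) (Ioi 0) := by
  have h := integrableOn_rpow_mul_exp_neg_mul_rpow (p := 1)
    (neg_one_lt_zero.trans_le n.cast_nonneg) one_pos hu
  refine Integrable.mono' h (by fun_prop) (ae_restrict_of_forall_mem measurableSet_Ioi ?_)
  intro t ht
  rw [norm_pow_mul_cexp n u (le_of_lt ht), Real.rpow_natCast, Real.rpow_one, neg_mul]

theorem integral_norm_pow_mul_cexp (n : ℕ) {u : ℂ} (hu : 0 < u.re) :
    ∫ t : ℝ in Ioi 0, ‖(t : ℂ) ^ n * Complex.exp (-u * t)‖ = n.factorial / u.re ^ (n + 1) := by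
  have h := Real.integral_rpow_mul_exp_neg_mul_Ioi n.cast_add_one_pos hu
  simp only [add_sub_cancel_right, Real.rpow_natCast] at h
  rw [setIntegral_congr_fun measurableSet_Ioi fun t ht => norm_pow_mul_cexp n u (le_of_lt ht), h,
    Real.Gamma_nat_eq_factorial, ← Nat.cast_succ, Real.rpow_natCast, one_div_pow,
    one_div_mul_eq_div]

theorem tendsto_pow_mul_cexp_atTop (n : ℕ) {u : ℂ} (hu : 0 < u.re) :
    Tendsto (fun t : ℝ => (t : ℂ) ^ n * Complex.exp (-u * t)) atTop (𝓝 0) := by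
  rw [tendsto_zero_iff_norm_tendsto_zero]
  refine (tendsto_rpow_mul_exp_neg_mul_atTop_nhds_zero n u.re hu).congr' ?_
  filter_upwards [eventually_ge_atTop 0] with t ht
  rw [norm_pow_mul_cexp n u ht, Real.rpow_natCast, neg_mul]

theorem mul_integral_pow_succ_mul_cexp (n : ℕ) {u : ℂ} (hu : 0 < u.re) :
    u * ∫ t : ℝ in Ioi 0, (t : ℂ) ^ (n + 1) * Complex.exp (-u * t) =
      (n + 1) * ∫ t : ℝ in Ioi 0, (t : ℂ) ^ n * Complex.exp (-u * t) := by
  have hderiv (t : ℝ) : HasDerivAt (fun t : ℝ => (t : ℂ) ^ (n + 1) * Complex.exp (-u * t))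
      ((n + 1) * ((t : ℂ) ^ n * Complex.exp (-u * t)) -
        u * ((t : ℂ) ^ (n + 1) * Complex.exp (-u * t))) t := by
    refine HasDerivAt.comp_ofReal (e := fun t => t ^ (n + 1) * Complex.exp (-u * t)) ?_
    refine ((hasDerivAt_pow (n + 1) (t : ℂ)).mul
      (((hasDerivAt_id (t : ℂ)).const_mul (-u)).cexp)).congr_deriv ?_
    rw [Nat.add_sub_cancel, mul_one, Nat.cast_succ, id]
    ring
  have hn := (integrableOn_pow_mul_cexp n hu).const_mul (n + 1 : ℂ)
  have hn' := (integrableOn_pow_mul_cexp (n + 1) hu).const_mul u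
  have h := integral_Ioi_of_hasDerivAt_of_tendsto' (a := 0) (fun t _ => hderiv t) (hn.sub hn')
    (tendsto_pow_mul_cexp_atTop (n + 1) hu)
  rw [integral_sub hn hn', integral_const_mul, integral_const_mul, Complex.ofReal_zero,
    zero_pow n.succ_ne_zero, zero_mul, sub_zero] at h
  exact (sub_eq_zero.1 h).symm

theorem integral_pow_mul_cexp (n : ℕ) {u : ℂ} (hu : 0 < u.re) :
    ∫ t : ℝ in Ioi 0, (t : ℂ) ^ n * Complex.exp (-u * t) = n.factorial / u ^ (n + 1) := by
  have hu0 : u ≠ 0 := fun h => hu.ne' (by rw [h, Complex.zero_re])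
  induction n with
  | zero =>
    have h := integral_exp_mul_complex_Ioi (a := -u) (by rwa [Complex.neg_re, neg_lt_zero]) 0
    simpa using h
  | succ n ih =>
    rw [← mul_right_inj' hu0, mul_integral_pow_succ_mul_cexp n hu, ih, Nat.factorial_succ,
      pow_succ u (n + 1)]
    push_cast
    field_simp

theorem integral_pow_mul_cexp_mul_besselC (p : ℕ) (s : ℝ) {u : ℂ} (hu : 0 < u.re) :
    ∫ t : ℝ in Ioi 0, (t : ℂ) ^ p * Complex.exp (-u * t) * besselC p (s * t) =
      Complex.exp (-s / u) / u ^ (p + 1) := by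
  have hu0 : u ≠ 0 := fun h => hu.ne' (by rw [h, Complex.zero_re])
  let c : ℕ → ℂ := fun k => (-s) ^ k / (k.factorial * (k + p).factorial)
  let F : ℕ → ℝ → ℂ := fun k t => c k * ((t : ℂ) ^ (k + p) * Complex.exp (-u * t))
  have hseries (t : ℝ) : (t : ℂ) ^ p * Complex.exp (-u * t) * besselC p (s * t) = ∑' k, F k t := by
    rw [besselC, Complex.ofReal_tsum, ← tsum_mul_left]
    refine tsum_congr fun k => ?_
    simp only [F, c]
    push_cast
    ring
  have hint (k : ℕ) : ∫ t in Ioi 0, F k t = (-s / u) ^ k / k.factorial / u ^ (p + 1) := by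
    have := Nat.cast_ne_zero (R := ℂ).2 (k + p).factorial_ne_zero
    simp only [F, c]
    rw [integral_const_mul, integral_pow_mul_cexp _ hu, div_pow, add_assoc k p 1, pow_add]
    field_simp
  have hnorm (k : ℕ) :
      ∫ t in Ioi 0, ‖F k t‖ = (|s| / u.re) ^ k / k.factorial / u.re ^ (p + 1) := by
    have := Nat.cast_ne_zero (R := ℝ).2 (k + p).factorial_ne_zero
    have hc : ‖c k‖ = |s| ^ k / (k.factorial * (k + p).factorial) := by
      rw [norm_div, norm_mul, norm_pow, norm_neg, Complex.norm_real, Complex.norm_natCast,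
        Complex.norm_natCast, Real.norm_eq_abs]
    simp only [F, norm_mul (c k)]
    rw [integral_const_mul, integral_norm_pow_mul_cexp _ hu, hc, div_pow, add_assoc k p 1, pow_add]
    field_simp
  have hsum := hasSum_integral_of_summable_integral_norm (F := F)
    (fun k => (integrableOn_pow_mul_cexp (k + p) hu).const_mul _)
    (by simpa only [hnorm] using (Real.summable_pow_div_factorial _).div_const _)
  simp only [hint, ← hseries] at hsum
  have hexp := NormedSpace.expSeries_div_hasSum_exp (-(s : ℂ) / u)
  rw [← Complex.exp_eq_exp_ℂ] at hexp
  exact hsum.unique (hexp.div_const _)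

end LaplaceBessel

section LaplaceTransform

theorem kernelK_eq_besselC {s t : ℝ} (hs : 0 < s) (ht : 0 < t) :
    kernelK s t = besselC 1 (s * t) := by
  have h : 0 < √(s * t) := Real.sqrt_pos.2 (mul_pos hs ht)
  have harg : (2 * √(s * t)) ^ 2 / 4 = s * t := by
    rw [mul_pow, Real.sq_sqrt (mul_pos hs ht).le]
    ring
  rw [kernelK, besselJ_eq, harg, pow_one, mul_div_cancel_left₀ _ two_ne_zero,
    mul_div_cancel_left₀ _ h.ne']

theorem mDensity_mul_one_sub_exp {t : ℝ} (ht : 0 < t) :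
    mDensity t * (1 - Real.exp (-t)) = t * Real.exp (-t) := by
  have h1 : Real.exp t - 1 ≠ 0 := by linarith [Real.add_one_lt_exp ht.ne']
  rw [mDensity, Real.exp_neg]
  field_simp

theorem integral_one_sub_cexp_mul (f : ℝ → ℂ) :
    ∫ t : ℝ, (1 - Complex.exp (-t)) * f t ∂m =
      ∫ t : ℝ in Ioi 0, t * Complex.exp (-t) * f t := by
  rw [m, integral_withDensity_eq_integral_toReal_smul measurable_mDensity.ennreal_ofReal
    (.of_forall fun _ => ENNReal.ofReal_lt_top)]
  refine setIntegral_congr_fun measurableSet_Ioi fun t ht => ?_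
  have h : (mDensity t : ℂ) * (1 - Complex.exp (-t)) = t * Complex.exp (-t) := by
    exact_mod_cast congrArg Complex.ofReal (mDensity_mul_one_sub_exp ht)
  rw [ENNReal.toReal_ofReal (mDensity_nonneg ht), Complex.real_smul, ← mul_assoc, h]

theorem integrable_cexp_m {v : ℂ} (hv : -1 < v.re) :
    Integrable (fun t : ℝ => Complex.exp (-(t : ℂ) * v)) m := by
  refine (integrable_norm_iff (by fun_prop)).1
    ((integrable_exp_m hv).congr (.of_forall fun t => ?_))
  simp only [Complex.norm_exp]
  rw [← Complex.ofReal_neg, Complex.re_ofReal_mul, neg_mul, neg_mul, mul_comm]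

theorem integrable_one_sub_cexp_mul_cexp {v : ℂ} (hv : -1 < v.re) :
    Integrable (fun t : ℝ => (1 - Complex.exp (-t)) * Complex.exp (-(t : ℂ) * v)) m := by
  have hv' : -1 < (v + 1).re := by
    rw [Complex.add_re, Complex.one_re]
    linarith
  refine ((integrable_cexp_m hv).sub (integrable_cexp_m hv')).congr (.of_forall fun t => ?_)
  simp only [Pi.sub_apply, sub_mul, one_mul]
  rw [← Complex.exp_add, mul_add, mul_one, add_comm (-(t : ℂ))]

theorem integral_one_sub_cexp_mul_kernelK {v : ℂ} (hv : -1 < v.re) {s : ℝ} (hs : 0 < s) :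
    ∫ t : ℝ, (1 - Complex.exp (-t)) * Complex.exp (-(t : ℂ) * v) * kernelK s t ∂m =
      Complex.exp (-s / (v + 1)) / (v + 1) ^ 2 := by
  have hv' : 0 < (v + 1).re := by
    rw [Complex.add_re, Complex.one_re]
    linarith
  simp only [mul_assoc (1 - _ : ℂ)]
  rw [← integral_pow_mul_cexp_mul_besselC 1 s hv', integral_one_sub_cexp_mul]
  refine setIntegral_congr_fun measurableSet_Ioi fun t ht => ?_
  have hexp : Complex.exp (-(v + 1) * t) = Complex.exp (-t) * Complex.exp (-(t : ℂ) * v) := by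
    rw [← Complex.exp_add]
    ring_nf
  rw [kernelK_eq_besselC hs ht, hexp]
  ring

theorem integral_mul_opK {a : ℝ → ℂ} (ha : Integrable a m) (φ : L2m) :
    ∫ t, a t * opK φ t ∂m = ∫ s, (∫ t, a t * kernelK s t ∂m) * φ s ∂m := by
  have hφ : Integrable φ m := (Lp.memLp φ).integrable one_le_two
  have hprod : Integrable (Function.uncurry fun t s : ℝ => a t * φ s * (kernelK s t : ℂ))
      (m.prod m) := by
    refine Integrable.mul_bdd (c := 1) (ha.mul_prod hφ) ?_ (.of_forall fun q => ?_)
    · exact (Complex.measurable_ofReal.comp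
        (measurable_kernelK.comp measurable_swap)).aestronglyMeasurable
    · rw [Complex.norm_real]
      exact abs_kernelK_le _ _
  calc ∫ t, a t * opK φ t ∂m = ∫ t, ∫ s, a t * φ s * (kernelK s t : ℂ) ∂m ∂m := by
        refine integral_congr_ae ?_
        filter_upwards [opK_apply_ae φ] with t ht
        rw [ht, ← integral_const_mul]
        simp only [mul_assoc, mul_comm (φ _)]
    _ = ∫ s, ∫ t, a t * φ s * (kernelK s t : ℂ) ∂m ∂m := integral_integral_swap hprod
    _ = ∫ s, (∫ t, a t * kernelK s t ∂m) * φ s ∂m := by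
        simp only [mul_right_comm _ (φ _), integral_mul_const]

/-- The Laplace transform `𝓛[φ]` as a function on `ℂ`, to which complex analysis applies. Off the
half-plane `Re w > -1/2` the integral may diverge, and the value is then `0`. -/
noncomputable def laplaceIntegral (φ : L2m) (w : ℂ) : ℂ :=
  ∫ t : ℝ, Complex.exp (-(t : ℂ) * w) * φ t ∂m

theorem laplace_apply (φ : L2m) (w : HalfPlane) : laplace φ w = laplaceIntegral φ w.1 := rfl

theorem laplaceIntegral_one_sub_opM_mul_opM_pow_mul_opK (n : ℕ) (φ : L2m) {w : ℂ}
    (hw : -1 < w.re) :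
    laplaceIntegral (((1 - opM) * opM ^ n * opK) φ) w =
      (1 / (w + (n + 1 : ℕ))) ^ 2 * laplaceIntegral φ (1 / (w + (n + 1 : ℕ))) := by
  have hre : -1 < (w + n).re := by
    rw [Complex.add_re, Complex.natCast_re]
    linarith [n.cast_nonneg (α := ℝ)]
  have hn : w + n + 1 = w + (n + 1 : ℕ) := by push_cast; ring
  have hM := (IsMultiplicationBy.one.sub isMultiplicationBy_opM).mul (isMultiplicationBy_opM.pow n)
  calc laplaceIntegral (((1 - opM) * opM ^ n * opK) φ) w
      = ∫ t : ℝ, (1 - Complex.exp (-t)) * Complex.exp (-(t : ℂ) * (w + n)) * opK φ t ∂m := by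
        refine integral_congr_ae ?_
        filter_upwards [hM (opK φ)] with t ht
        rw [mul_apply_eq_comp, ht, mul_add, Complex.exp_add, mul_comm (-(t : ℂ)) n,
          Complex.exp_nat_mul]
        simp only [Pi.mul_apply, Pi.sub_apply, Pi.one_apply, Pi.pow_apply]
        ring
    _ = ∫ s, Complex.exp (-s / (w + (n + 1 : ℕ))) / (w + (n + 1 : ℕ)) ^ 2 * φ s ∂m := by
        rw [integral_mul_opK (integrable_one_sub_cexp_mul_cexp hre)]
        refine integral_congr_ae (ae_m_of_forall_pos fun s hs => ?_)
        simp only [integral_one_sub_cexp_mul_kernelK hre hs, hn]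
    _ = (1 / (w + (n + 1 : ℕ))) ^ 2 * laplaceIntegral φ (1 / (w + (n + 1 : ℕ))) := by
        rw [laplaceIntegral, ← integral_const_mul]
        refine integral_congr_ae (.of_forall fun s => ?_)
        simp only [div_eq_mul_inv, one_mul, inv_pow]
        ring

theorem continuous_laplace_apply (w : HalfPlane) : Continuous fun φ : L2m => laplace φ w := by
  let w' : HalfPlane := ⟨starRingEnd ℂ w.1, by simpa only [Complex.conj_re] using w.2⟩
  have h : (fun φ : L2m => laplace φ w) = innerSL ℂ (memLp_cexp w').toLp := by
    funext φ
    rw [innerSL_apply_apply, L2.inner_def]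
    refine integral_congr_ae ?_
    filter_upwards [(memLp_cexp w').coeFn_toLp] with t ht
    rw [ht, RCLike.inner_apply, ← Complex.exp_conj, map_mul, map_neg, Complex.conj_ofReal,
      Complex.conj_conj, mul_comm]
  rw [h]
  exact (innerSL ℂ (memLp_cexp w').toLp).continuous

theorem hasSum_laplace_opKz {z : ℂ} (hz : ‖z‖ < 1) (φ : L2m) (w : HalfPlane) :
    HasSum (fun n : ℕ => z ^ (n + 1) * (1 / (w.1 + (n + 1 : ℕ))) ^ 2 *
      laplace φ (gaussBranch n w)) (laplace (opKz z φ) w) := by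
  have hw : -1 < w.1.re := by linarith [w.2]
  have h := ((ContinuousLinearMap.apply ℂ L2m φ).hasSum (hasSum_opKz hz)).map
    (LinearMap.proj w ∘ₗ laplace) (continuous_laplace_apply w)
  refine h.congr_fun fun n => ?_
  rw [mul_assoc, laplace_apply, gaussBranch,
    ← laplaceIntegral_one_sub_opM_mul_opM_pow_mul_opK n φ hw]
  simp only [Function.comp_apply, map_smul, ContinuousLinearMap.apply_apply, smul_eq_mul]
  rfl

end LaplaceTransform

section GaussContraction

variable {f : ℂ → ℂ} {C : ℝ} {z a : ℂ} {x : ℝ}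

-- The weight `1 + y` is the reciprocal of the Gauss density: it makes the bound telescope.
theorem norm_gauss_term_le (hf : ∀ y ∈ Icc (0 : ℝ) 1, (1 + y) * ‖f y‖ ≤ C) (hz : ‖z‖ ≤ 1)
    (hx : 0 ≤ x) (n : ℕ) :
    ‖z ^ (n + 1) * (1 / ((x : ℂ) + (n + 1 : ℕ))) ^ 2 * f (1 / ((x : ℂ) + (n + 1 : ℕ)))‖ ≤
      ‖z‖ * C * (1 / (1 + x + n) - 1 / (1 + x + (n + 1 : ℕ))) := by
  have hy : 0 < 1 + x + n := by positivity
  have hcast : (x : ℂ) + (n + 1 : ℕ) = ((1 + x + n : ℝ) : ℂ) := by push_cast; ring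
  have hfy : ‖f ((1 / (1 + x + n) : ℝ) : ℂ)‖ ≤ C / (1 + 1 / (1 + x + n)) := by
    rw [le_div_iff₀' (by positivity)]
    exact hf _ ⟨by positivity, (div_le_one hy).2 (by linarith)⟩
  rw [hcast, ← Complex.ofReal_one, ← Complex.ofReal_div, norm_mul, norm_mul, norm_pow, norm_pow,
    Complex.norm_real, Real.norm_of_nonneg (by positivity)]
  calc ‖z‖ ^ (n + 1) * (1 / (1 + x + n)) ^ 2 * ‖f ((1 / (1 + x + n) : ℝ) : ℂ)‖
      ≤ ‖z‖ * (1 / (1 + x + n)) ^ 2 * (C / (1 + 1 / (1 + x + n))) := by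
        gcongr
        exact pow_le_of_le_one (norm_nonneg _) hz n.succ_ne_zero
    _ = ‖z‖ * C * (1 / (1 + x + n) - 1 / (1 + x + (n + 1 : ℕ))) := by
        push_cast
        field_simp
        ring

theorem one_add_mul_norm_gauss_sum_le (hf : ∀ y ∈ Icc (0 : ℝ) 1, (1 + y) * ‖f y‖ ≤ C)
    (hz : ‖z‖ ≤ 1) (hx : 0 ≤ x)
    (ha : HasSum (fun n : ℕ => z ^ (n + 1) * (1 / ((x : ℂ) + (n + 1 : ℕ))) ^ 2 *
      f (1 / ((x : ℂ) + (n + 1 : ℕ)))) a) :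
    (1 + x) * ‖a‖ ≤ ‖z‖ * C := by
  have hC : 0 ≤ C := le_trans (by positivity) (hf 0 ⟨le_rfl, zero_le_one⟩)
  have hbound : ‖a‖ ≤ ‖z‖ * C * (1 / (1 + x)) := by
    refine le_of_tendsto ha.tendsto_sum_nat.norm (.of_forall fun N => ?_)
    refine (norm_sum_le_of_le _ fun n _ => norm_gauss_term_le hf hz hx n).trans ?_
    rw [← Finset.mul_sum, Finset.sum_range_sub' (fun n : ℕ => 1 / (1 + x + (n : ℝ))),
      Nat.cast_zero, add_zero]
    gcongr
    exact sub_le_self _ (by positivity)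
  rwa [mul_one_div, le_div_iff₀' (by positivity)] at hbound

end GaussContraction

section FixedVector

theorem one_add_mul_norm_laplaceIntegral_opKz_le {z : ℂ} (hz : ‖z‖ < 1) (φ : L2m) {C : ℝ}
    (hC : ∀ y ∈ Icc (0 : ℝ) 1, (1 + y) * ‖laplaceIntegral φ y‖ ≤ C) {x : ℝ} (hx : 0 ≤ x) :
    (1 + x) * ‖laplaceIntegral (opKz z φ) x‖ ≤ ‖z‖ * C := by
  have hre : -(1 / 2) < (x : ℂ).re := by
    rw [Complex.ofReal_re]
    linarith
  exact one_add_mul_norm_gauss_sum_le hC hz.le hx (hasSum_laplace_opKz hz φ ⟨x, hre⟩)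

theorem norm_laplaceIntegral_le (φ : L2m) {x : ℝ} (hx : 0 ≤ x) :
    ‖laplaceIntegral φ x‖ ≤ ∫ t, ‖φ t‖ ∂m := by
  have hφ : Integrable φ m := (Lp.memLp φ).integrable one_le_two
  refine norm_integral_le_of_norm_le hφ.norm (ae_m_of_forall_pos fun t ht => ?_)
  rw [norm_mul, Complex.norm_exp, ← Complex.ofReal_neg, ← Complex.ofReal_mul, Complex.ofReal_re]
  refine mul_le_of_le_one_left (norm_nonneg _) (Real.exp_le_one_iff.2 ?_)
  exact mul_nonpos_of_nonpos_of_nonneg (neg_nonpos.2 ht.le) hx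

theorem laplaceIntegral_eq_zero_of_opKz_apply_eq {z : ℂ} (hz : ‖z‖ < 1) {φ : L2m}
    (hφ : opKz z φ = φ) {x : ℝ} (hx : x ∈ Icc (0 : ℝ) 1) : laplaceIntegral φ x = 0 := by
  have hiter (N : ℕ) : ∀ y ∈ Icc (0 : ℝ) 1,
      (1 + y) * ‖laplaceIntegral φ y‖ ≤ ‖z‖ ^ N * (2 * ∫ t, ‖φ t‖ ∂m) := by
    induction N with
    | zero =>
      intro y hy
      rw [pow_zero, one_mul]
      exact mul_le_mul (by linarith [hy.2]) (norm_laplaceIntegral_le φ hy.1) (norm_nonneg _)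
        zero_le_two
    | succ N ih =>
      intro y hy
      have h := one_add_mul_norm_laplaceIntegral_opKz_le hz φ ih hy.1
      rwa [hφ, ← mul_assoc, ← pow_succ'] at h
  have hlim : Tendsto (fun N : ℕ => ‖z‖ ^ N * (2 * ∫ t, ‖φ t‖ ∂m)) atTop (𝓝 0) := by
    simpa only [zero_mul] using
      (tendsto_pow_atTop_nhds_zero_of_lt_one (norm_nonneg z) hz).mul_const _
  have hle := ge_of_tendsto' hlim fun N => hiter N x hx
  have hpos : 0 < 1 + x := by linarith [hx.1]
  exact norm_le_zero_iff.1 (nonpos_of_mul_nonpos_right hle hpos)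

theorem norm_mul_cexp_neg_mul_le {ε t : ℝ} (hε : 0 < ε) (ht : 0 ≤ t) {w w₀ : ℂ}
    (hw : ‖w - w₀‖ ≤ ε) :
    ‖-(t : ℂ) * Complex.exp (-t * w)‖ ≤
      ε⁻¹ * ‖Complex.exp (-t * (w₀ - (2 * ε : ℝ)))‖ := by
  have hre : w₀.re - ε ≤ w.re := by
    have h := (Complex.abs_re_le_norm (w - w₀)).trans hw
    rw [Complex.sub_re] at h
    linarith [neg_le_of_abs_le h]
  have hle : t ≤ ε⁻¹ * Real.exp (ε * t) := by
    rw [inv_mul_eq_div, le_div_iff₀' hε]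
    linarith [Real.add_one_le_exp (ε * t)]
  rw [norm_mul, norm_neg, Complex.norm_real, Real.norm_of_nonneg ht, Complex.norm_exp,
    Complex.norm_exp, ← Complex.ofReal_neg, Complex.re_ofReal_mul, Complex.re_ofReal_mul,
    Complex.sub_re, Complex.ofReal_re]
  calc t * Real.exp (-t * w.re) ≤ ε⁻¹ * Real.exp (ε * t) * Real.exp (-t * (w₀.re - ε)) := by
        gcongr ?_ * Real.exp ?_
        exact mul_le_mul_of_nonpos_left hre (neg_nonpos.2 ht)
    _ = ε⁻¹ * Real.exp (-t * (w₀.re - 2 * ε)) := by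
        rw [mul_assoc, ← Real.exp_add]
        ring_nf

theorem differentiableOn_integral_cexp_neg_mul {μ : Measure ℝ} (hμ : ∀ᵐ t ∂μ, 0 ≤ t) {f : ℝ → ℂ}
    {b : ℝ}
    (hf : ∀ w : ℂ, b < w.re → Integrable (fun t : ℝ => Complex.exp (-(t : ℂ) * w) * f t) μ) :
    DifferentiableOn ℂ (fun w : ℂ => ∫ t : ℝ, Complex.exp (-(t : ℂ) * w) * f t ∂μ)
      {w | b < w.re} := by
  intro w₀ hw₀
  obtain ⟨ε, hε, hεb⟩ : ∃ ε > 0, b < w₀.re - 2 * ε :=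
    ⟨(w₀.re - b) / 3, by linarith [hw₀.out], by linarith [hw₀.out]⟩
  have hbound := (hf (w₀ - (2 * ε : ℝ)) (by rwa [Complex.sub_re, Complex.ofReal_re])).norm
  have hF := hf w₀ hw₀
  have hderiv (t : ℝ) (w : ℂ) : HasDerivAt (fun w : ℂ => Complex.exp (-(t : ℂ) * w) * f t)
      (-(t : ℂ) * Complex.exp (-(t : ℂ) * w) * f t) w := by
    have h : HasDerivAt (fun w : ℂ => -(t : ℂ) * w) (-(t : ℂ)) w := by
      simpa only [mul_one] using (hasDerivAt_id' w).const_mul (-(t : ℂ))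
    simpa only [mul_comm (-(t : ℂ)) (Complex.exp _)] using h.cexp.mul_const (f t)
  refine (hasDerivAt_integral_of_dominated_loc_of_deriv_le (Metric.ball_mem_nhds w₀ hε)
    ?_ hF ?_ ?_ (hbound.const_mul ε⁻¹)
    (.of_forall fun t w _ => hderiv t w)).2.differentiableAt.differentiableWithinAt
  · filter_upwards [(isOpen_lt continuous_const Complex.continuous_re).mem_nhds hw₀] with w hw
    exact (hf w hw).aestronglyMeasurable
  · simp only [mul_assoc]
    exact AEStronglyMeasurable.mul (by fun_prop) hF.aestronglyMeasurable
  · filter_upwards [hμ] with t ht w hw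
    rw [norm_mul, norm_mul (Complex.exp _), ← mul_assoc]
    gcongr
    exact norm_mul_cexp_neg_mul_le hε ht (mem_ball_iff_norm.1 hw).le

theorem differentiableOn_laplaceIntegral (φ : L2m) :
    DifferentiableOn ℂ (laplaceIntegral φ) {w | -(1 / 2) < w.re} :=
  differentiableOn_integral_cexp_neg_mul (ae_m_of_forall_pos fun _ ht => ht.le)
    fun w hw => integrable_laplace ⟨w, hw⟩ φ

theorem eq_zero_of_laplaceIntegral_eq_zero {φ : L2m}
    (hφ : ∀ x ∈ Icc (0 : ℝ) 1, laplaceIntegral φ x = 0) : φ = 0 := by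
  have hopen : IsOpen {w : ℂ | -(1 / 2) < w.re} := isOpen_lt continuous_const Complex.continuous_re
  have hconn : IsPreconnected {w : ℂ | -(1 / 2) < w.re} :=
    (convex_halfSpace_re_gt _).isPreconnected
  have hmem : ((1 / 2 : ℝ) : ℂ) ∈ {w : ℂ | -(1 / 2) < w.re} := by
    rw [mem_ofPred_eq, Complex.ofReal_re]
    norm_num
  have hIcc : ∀ᶠ x : ℝ in 𝓝[≠] (1 / 2), x ∈ Icc (0 : ℝ) 1 :=
    eventually_nhdsWithin_of_eventually_nhds (Icc_mem_nhds (by norm_num) (by norm_num))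
  have hofReal : Tendsto Complex.ofReal (𝓝[≠] (1 / 2)) (𝓝[≠] ((1 / 2 : ℝ) : ℂ)) :=
    Complex.continuous_ofReal.continuousAt.tendsto.inf
      (tendsto_principal_principal.2 fun x hx => Complex.ofReal_injective.ne hx)
  have hzero := ((differentiableOn_laplaceIntegral φ).analyticOnNhd
    hopen).eqOn_zero_of_preconnected_of_frequently_eq_zero hconn hmem
    (hofReal.frequently (hIcc.mono hφ).frequently)
  refine laplace_injective (funext fun w => ?_)
  rw [map_zero]
  exact hzero w.2

theorem not_hasEigenvalue_opKz {z : ℂ} (hz : ‖z‖ < 1) :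
    ¬ Module.End.HasEigenvalue (opKz z : L2m →ₗ[ℂ] L2m) 1 := by
  intro h
  obtain ⟨φ, hφ⟩ := h.exists_hasEigenvector
  have hfix : opKz z φ = φ := hφ.apply_eq_smul.trans (one_smul ℂ φ)
  exact hφ.2 (eq_zero_of_laplaceIntegral_eq_zero fun x hx =>
    laplaceIntegral_eq_zero_of_opKz_apply_eq hz hfix hx)

end FixedVector

section CutPlane

theorem zero_mem_cutPlane : (0 : ℂ) ∈ cutPlane := by
  intro x hx h
  rw [Complex.ofReal_eq_zero.1 h.symm] at hx
  exact hx.not_gt one_pos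

theorem ball_subset_cutPlane : Metric.ball (0 : ℂ) 1 ⊆ cutPlane := by
  intro z hz x hx h
  rw [mem_ball_zero_iff, h, Complex.norm_real, Real.norm_of_nonneg (zero_le_one.trans hx)] at hz
  exact hx.not_gt hz

theorem starConvex_cutPlane : StarConvex ℝ (0 : ℂ) cutPlane := by
  rw [starConvex_zero_iff]
  intro z hz a ha0 ha1 x hx h
  obtain rfl | ha : a = 0 ∨ 0 < a := ha0.eq_or_lt.imp_left Eq.symm
  · exact zero_mem_cutPlane x hx (by rwa [zero_smul] at h)
  · refine hz (x / a) ((one_le_div ha).2 (ha1.trans hx)) ?_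
    rw [Complex.ofReal_div, ← h, Complex.real_smul,
      mul_div_cancel_left₀ _ (Complex.ofReal_ne_zero.2 ha.ne')]

theorem isPreconnected_cutPlane : IsPreconnected cutPlane :=
  (starConvex_cutPlane.isPathConnected zero_mem_cutPlane).isConnected.isPreconnected

end CutPlane

section TransferOperator

/-- The operators `𝓠_z` on `H₁`, for all `z` in the cut plane: the conjugates of `𝓚_z` under the
Laplace transform. -/
noncomputable def opQ (z : ℂ) : H1 →L[ℂ] H1 :=
  laplaceIsometry.toContinuousLinearEquiv.conjContinuousAlgEquiv (opKz z)

theorem opQ_laplaceIsometry (z : ℂ) (φ : L2m) :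
    opQ z (laplaceIsometry φ) = laplaceIsometry (opKz z φ) :=
  congrArg (fun ψ => laplaceIsometry (opKz z ψ)) (laplaceIsometry.symm_apply_apply φ)

theorem isTransferOperator_opQ {z : ℂ} (hz : ‖z‖ < 1) : IsTransferOperator z (opQ z) := by
  intro f w
  obtain ⟨φ, rfl⟩ := laplaceIsometry.surjective f
  rw [opQ_laplaceIsometry]
  exact hasSum_laplace_opKz hz φ w

theorem analyticOnNhd_opQ : AnalyticOnNhd ℂ opQ cutPlane := fun _ hz =>
  let e := laplaceIsometry.toContinuousLinearEquiv.arrowCongr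
    laplaceIsometry.toContinuousLinearEquiv
  ((e : (L2m →L[ℂ] L2m) →L[ℂ] H1 →L[ℂ] H1).analyticAt _).comp_of_eq (analyticAt_opKz hz) rfl

theorem isCompactOperator_opQ (z : ℂ) : IsCompactOperator (opQ z) :=
  ((isCompactOperator_opKz z).comp_clm
    (laplaceIsometry.symm.toContinuousLinearEquiv : H1 →L[ℂ] L2m)).clm_comp
    (laplaceIsometry.toContinuousLinearEquiv : L2m →L[ℂ] H1)

theorem isUnit_one_sub_opQ_iff (z : ℂ) :
    IsUnit (1 - opQ z) ↔ ¬ Module.End.HasEigenvalue (opKz z : L2m →ₗ[ℂ] L2m) 1 := by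
  rw [← isUnit_one_sub_iff_not_hasEigenvalue (isCompactOperator_opKz z), opQ,
    ← map_one laplaceIsometry.toContinuousLinearEquiv.conjContinuousAlgEquiv, ← map_sub,
    MulEquiv.isUnit_map]

theorem isUnit_one_sub_opQ {z : ℂ} (hz : ‖z‖ < 1) : IsUnit (1 - opQ z) :=
  (isUnit_one_sub_opQ_iff z).2 (not_hasEigenvalue_opKz hz)

theorem analyticAt_ringInverse_one_sub_opQ {z : ℂ} (hz : z ∈ cutPlane) (hu : IsUnit (1 - opQ z)) :
    AnalyticAt ℂ (fun z => Ring.inverse (1 - opQ z)) z :=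
  analyticAt_ringInverse (analyticAt_const.sub (analyticOnNhd_opQ z hz)) hu

theorem meromorphicOn_ringInverse_one_sub_opQ :
    MeromorphicOn (fun z => Ring.inverse (1 - opQ z)) cutPlane := fun z hz =>
  meromorphicAt_ringInverse_one_sub (analyticOnNhd_opQ z hz) (isCompactOperator_opQ z)

theorem m_ne_zero : m ≠ 0 := by
  intro h
  have hden : ∀ᵐ t ∂volume.restrict (Ioi (0 : ℝ)), ENNReal.ofReal (mDensity t) = 0 :=
    (withDensity_eq_zero_iff measurable_mDensity.ennreal_ofReal.aemeasurable).1 h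
  have hvol : ∀ᵐ _ ∂volume.restrict (Ioi (0 : ℝ)), False := by
    filter_upwards [hden, ae_restrict_mem measurableSet_Ioi] with _ ht htpos
    refine (ENNReal.ofReal_pos.2 ?_).ne' ht
    exact div_pos htpos (sub_pos.2 (Real.one_lt_exp_iff.2 htpos))
  rw [eventually_false_iff_eq_bot, ae_eq_bot, Measure.restrict_eq_zero, Real.volume_Ioi] at hvol
  exact ENNReal.top_ne_zero hvol

instance nontrivial_L2m : Nontrivial L2m := by
  refine ⟨(memLp_const (1 : ℂ)).toLp, 0, fun h => m_ne_zero ?_⟩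
  rw [← ae_eq_bot, ← eventually_false_iff_eq_bot]
  filter_upwards [(memLp_const (μ := m) (p := 2) (1 : ℂ)).coeFn_toLp,
    Lp.eq_zero_iff_ae_eq_zero.1 h] with t hone hzero
  exact one_ne_zero (hone.symm.trans hzero)

instance nontrivial_H1 : Nontrivial H1 := laplaceIsometry.symm.toEquiv.nontrivial

theorem meromorphicOrderAt_ringInverse_one_sub_opQ_neg_iff {z : ℂ} (hz : z ∈ cutPlane) :
    meromorphicOrderAt (fun z => Ring.inverse (1 - opQ z)) z < 0 ↔
      Module.End.HasEigenvalue (opKz z : L2m →ₗ[ℂ] L2m) 1 := by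
  have hu : IsUnit (1 - opQ 0) := isUnit_one_sub_opQ (by rw [norm_zero]; exact one_pos)
  have htop := meromorphicOrderAt_ringInverse_one_sub_ne_top isPreconnected_cutPlane
    analyticOnNhd_opQ (fun w _ => isCompactOperator_opQ w) zero_mem_cutPlane hu hz
  rw [meromorphicOrderAt_ringInverse_neg_iff (f := fun z => 1 - opQ z)
    (analyticAt_const.sub (analyticOnNhd_opQ z hz)) (meromorphicOn_ringInverse_one_sub_opQ z hz)
    htop, isUnit_one_sub_opQ_iff, not_not]

end TransferOperator

end FareyGauss

theorem corollary2 :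
    ∃ Q : ℂ → (FareyGauss.H1 →L[ℂ] FareyGauss.H1),
      (∀ z ∈ Metric.ball (0 : ℂ) 1, FareyGauss.IsTransferOperator z (Q z)) ∧
      AnalyticOnNhd ℂ Q FareyGauss.cutPlane ∧
      (∀ z ∈ Metric.ball (0 : ℂ) 1, IsUnit (1 - Q z)) ∧
      AnalyticOnNhd ℂ (fun z => Ring.inverse (1 - Q z)) (Metric.ball (0 : ℂ) 1) ∧
      MeromorphicOn (fun z => Ring.inverse (1 - Q z)) FareyGauss.cutPlane ∧
      ∀ z ∈ FareyGauss.cutPlane,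
        (meromorphicOrderAt (fun ζ => Ring.inverse (1 - Q ζ)) z < 0 ↔
          Module.End.HasEigenvalue
            (FareyGauss.opKz z : FareyGauss.L2m →ₗ[ℂ] FareyGauss.L2m) 1) ∧
        (¬ Module.End.HasEigenvalue
            (FareyGauss.opKz z : FareyGauss.L2m →ₗ[ℂ] FareyGauss.L2m) 1 →
          IsUnit (1 - Q z) ∧ AnalyticAt ℂ (fun ζ => Ring.inverse (1 - Q ζ)) z) := by
  have hball : ∀ z ∈ Metric.ball (0 : ℂ) 1, IsUnit (1 - FareyGauss.opQ z) := fun z hz =>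
    FareyGauss.isUnit_one_sub_opQ (mem_ball_zero_iff.1 hz)
  refine ⟨FareyGauss.opQ,
    fun z hz => FareyGauss.isTransferOperator_opQ (mem_ball_zero_iff.1 hz),
    FareyGauss.analyticOnNhd_opQ, hball,
    fun z hz => FareyGauss.analyticAt_ringInverse_one_sub_opQ
      (FareyGauss.ball_subset_cutPlane hz) (hball z hz),
    FareyGauss.meromorphicOn_ringInverse_one_sub_opQ, fun z hz =>
    ⟨FareyGauss.meromorphicOrderAt_ringInverse_one_sub_opQ_neg_iff hz, fun hne => ?_⟩⟩
  have hu := (FareyGauss.isUnit_one_sub_opQ_iff z).2 hne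
  exact ⟨hu, FareyGauss.analyticAt_ringInverse_one_sub_opQ hz hu⟩
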